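/- Let $N\ge 1$, let $\mu,\nu$ be Borel probability measures on $\mathbb R^N$, and let $\Pi(\mu,\nu)$ be the set of probability measures on $\mathbb R^N\times\mathbb R^N$ with marginals $\mu$ and $\nu$. Let $\mathcal F_t$ be the $\sigma$-algebra on $\mathbb R^N$ generated by the first $t$ coordinates. A plan $\gamma\in\Pi(\mu,\nu)$ with disintegration $\gamma(dx,dy)=\mu(dx)\,\gamma^x(dy)$ is *causal* if for all $t\le N$ and $B\in\mathcal F_t$ the map $x\mapsto\gamma^x(B)$ coincides $\mu$-a.e. with an $\mathcal F_t$-measurable function; write $\gamma\in\Pi_c(\mu,\nu)$. It is *bicausal*, $\gamma\in\Pi_{bc}(\mu,\nu)$, if in addition its image under $(x,y)\mapsto(y,x)$ belongs to $\Pi_c(\nu,\mu)$. Let $c:\mathbb R^N\times\mathbb R^N\to\mathbb R\cup\{+\infty\}$ be lower semicontinuous, bounded from below and of the form $$c(x,y)=c_1(x_1,y_1)+\sum_{1<t\le N}c_t(x_t-x_{t-1},\,y_t-y_{t-1}),\qquad c_t:\mathbb R\times\mathbb R\to\mathbb R\cup\{+\infty\},$$ and let $\mu$ have independent increments, i.e.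 the variables $x_1,\,x_2-x_1,\dots,x_N-x_{N-1}$ are mutually independent under $\mu$. For a probability measure $\eta$ on $\mathbb R$ let $F_\eta(y)=\eta((-\infty,y])$ and $F_\eta^{-1}(u)=\inf\{y: F_\eta(y)\ge u\}$; let $\mu^{x_1,\dots,x_{t-1}}$ be the regular conditional law of $x_t$ given $x_1,\dots,x_{t-1}$ under $\mu$ (for $t=1$, the law $\mu_1$ of $x_1$), and similarly for $\nu$. The Knothe–Rosenblatt rearrangement of $\mu$ and $\nu$ is the law of $(X_1^*,\dots,X_N^*,Y_1^*,\dots,Y_N^*)$, where $U_1,\dots,U_N$ are independent and uniform on $[0,1]$ and, inductively for $t=1,\dots,N$, $$X_t^*=F^{-1}_{\mu^{X_1^*,\dots,X_{t-1}^*}}(U_t),\qquad Y_t^*=F^{-1}_{\nu^{Y_1^*,\dots,Y_{t-1}^*}}(U_t).$$ The Knothe–Rosenblatt map $T=(T^1,\dots,T^N)$ is defined inductively by $$T^t(x)=F^{-1}_{\nu^{T^1(x),\dots,T^{t-1}(x)}}\bigl(F_{\mu^{x_1,\dots,x_{t-1}}}(x_t)\bigr),\qquad t=1,\dots,N.$$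 Then: 1. The causal and bicausal values coincide: $\displaystyle\inf_{\gamma\in\Pi_c(\mu,\nu)}\int c\,d\gamma=\inf_{\gamma\in\Pi_{bc}(\mu,\nu)}\int c\,d\gamma$. 2. If moreover $c_t(a,b)=h_t(a-b)$ with $h_t:\mathbb R\to\mathbb R\cup\{+\infty\}$ convex for every $t$, then the Knothe–Rosenblatt rearrangement belongs to $\Pi_c(\mu,\nu)$ and attains the causal infimum. 3. If the laws under $\mu$ of $x_1,\,x_2-x_1,\dots,x_N-x_{N-1}$ are all atomless, then the Knothe–Rosenblatt rearrangement is induced by the Monge map $T$: $T$ is Borel, $T_*\mu=\nu$, and the rearrangement equals $(\mathrm{id}\times T)_*\mu$. -/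

import Mathlib

open MeasureTheory ProbabilityTheory
open scoped ENNReal

namespace CausalTransport

noncomputable section

/-- Trajectories of a real-valued process with `n` time steps. -/
abbrev Path (n : ℕ) : Type := Fin n → ℝ

/-- The integral of an extended-real function, `∫ f⁺ dμ - ∫ f⁻ dμ`.  It is only used for
measurable functions bounded from below and probability measures, so `∫ f⁻ dμ < ∞`. -/
def extIntegral {α : Type*} [MeasurableSpace α] (μ : Measure α) (f : α → EReal) : EReal :=
  ((∫⁻ x, (f x).toENNReal ∂μ : ℝ≥0∞) : EReal) - ((∫⁻ x, (-f x).toENNReal ∂μ : ℝ≥0∞) : EReal)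

/-- Convexity of a function on the line with values in `ℝ ∪ {+∞}`. -/
def IsConvex (h : ℝ → EReal) : Prop :=
  ∀ x y a b : ℝ, 0 < a → 0 < b → a + b = 1 →
    h (a * x + b * y) ≤ (a : EReal) * h x + (b : EReal) * h y

/-! ### Causal and bicausal transport plans -/

/-- The transport plans `Π(μ, ν)`. -/
def plans {n : ℕ} (μ ν : Measure (Path n)) : Set (Measure (Path n × Path n)) :=
  {γ | γ.map Prod.fst = μ ∧ γ.map Prod.snd = ν}

/-- The causal transport plans `Π_c(μ, ν)`: the regular conditional kernel `κ = γ^x` of `γ` with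
respect to the first coordinate is such that `x ↦ κ x B` is, up to a `μ`-null set, measurable with
respect to `x₁, …, x_t` for each `t` and each `B` in the σ-algebra of `y₁, …, y_t`.
`Filtration.piLE` is the filtration generated by the coordinate process. -/
def causalPlans {n : ℕ} (μ ν : Measure (Path n)) : Set (Measure (Path n × Path n)) :=
  {γ | γ ∈ plans μ ν ∧ ∃ κ : Kernel (Path n) (Path n), IsMarkovKernel κ ∧ μ.compProd κ = γ ∧
    ∀ (t : Fin n) (B : Set (Path n)),
      MeasurableSet[Filtration.piLE (X := fun _ : Fin n => ℝ) t] B →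
      ∃ f : Path n → ℝ≥0∞, Measurable[Filtration.piLE (X := fun _ : Fin n => ℝ) t] f ∧
        (fun x => κ x B) =ᵐ[μ] f}

/-- The bicausal transport plans `Π_bc(μ, ν)`. -/
def bicausalPlans {n : ℕ} (μ ν : Measure (Path n)) : Set (Measure (Path n × Path n)) :=
  {γ | γ ∈ causalPlans μ ν ∧ γ.map Prod.swap ∈ causalPlans ν μ}

/-- The value of the causal transport problem. -/
def causalValue {n : ℕ} (μ ν : Measure (Path n)) (c : Path n × Path n → EReal) : EReal :=
  ⨅ γ ∈ causalPlans μ ν, extIntegral γ c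

/-- The value of the bicausal transport problem. -/
def bicausalValue {n : ℕ} (μ ν : Measure (Path n)) (c : Path n × Path n → EReal) : EReal :=
  ⨅ γ ∈ bicausalPlans μ ν, extIntegral γ c

/-- `γ` is a solution of the causal transport problem. -/
def IsCausalOptimal {n : ℕ} (μ ν : Measure (Path n)) (c : Path n × Path n → EReal)
    (γ : Measure (Path n × Path n)) : Prop :=
  γ ∈ causalPlans μ ν ∧ extIntegral γ c = causalValue μ ν c

/-! ### Increments -/

/-- The increments `x₁, x₂ - x₁, …` of a trajectory. -/
def incr {N : ℕ} (x : Path (N + 1)) : Path (N + 1) :=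
  Fin.cons (x 0) (fun i : Fin N => x i.succ - x i.castSucc)

/-- The coordinate process has independent increments under `μ`; the initial value counts as
the first increment. -/
def HasIndependentIncrements {N : ℕ} (μ : Measure (Path (N + 1))) : Prop :=
  iIndepFun (fun (t : Fin (N + 1)) (x : Path (N + 1)) => incr x t) μ

/-- The cost `c₁(x₁, y₁) + ∑_{t > 1} c_t(x_t - x_{t-1}, y_t - y_{t-1})`. -/
def incrementCost {N : ℕ} (c : Fin (N + 1) → ℝ → ℝ → EReal)
    (p : Path (N + 1) × Path (N + 1)) : EReal :=
  c 0 (p.1 0) (p.2 0) +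
    ∑ i : Fin N, c i.succ (p.1 i.succ - p.1 i.castSucc) (p.2 i.succ - p.2 i.castSucc)

/-! ### The Knothe-Rosenblatt rearrangement -/

/-- The left-continuous generalized inverse of the distribution function of `η`. -/
def quantile (η : Measure ℝ) (u : ℝ) : ℝ := sInf {y : ℝ | u ≤ cdf η y}

/-- The conditional law of `x_t` under `μ` given `(x_s)_{s < t}`; for the first time step this is
the law of the first coordinate. -/
def condLaw {n : ℕ} (μ : Measure (Path n)) [IsFiniteMeasure μ] (t : Fin n) :
    Kernel (Set.Iio t → ℝ) ℝ :=
  condDistrib (fun x : Path n => x t) (Set.domRestrict (Set.Iio t)) μ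

/-- The quantile transform `X*` of `μ` driven by `u`. -/
def quantileTransform {n : ℕ} (μ : Measure (Path n)) [IsFiniteMeasure μ] (u : Path n)
    (t : Fin n) : ℝ :=
  quantile (condLaw μ t (fun s : Set.Iio t => quantileTransform μ u s.1)) (u t)
termination_by t
decreasing_by exact s.2

/-- The Knothe-Rosenblatt rearrangement: the law of `(X*, Y*)`, where the quantile transforms of
`μ` and of `ν` are driven by the same independent uniform variables on `[0, 1]`. -/
def knotheRosenblatt {n : ℕ} (μ ν : Measure (Path n)) [IsFiniteMeasure μ] [IsFiniteMeasure ν] :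
    Measure (Path n × Path n) :=
  (Measure.pi fun _ : Fin n => (volume : Measure ℝ).restrict (Set.Icc 0 1)).map
    (fun u => (quantileTransform μ u, quantileTransform ν u))

/-- The Knothe-Rosenblatt map `T`. -/
def knotheRosenblattMap {n : ℕ} (μ ν : Measure (Path n)) [IsFiniteMeasure μ] [IsFiniteMeasure ν]
    (x : Path n) (t : Fin n) : ℝ :=
  quantile (condLaw ν t (fun s : Set.Iio t => knotheRosenblattMap μ ν x s.1))
    (cdf (condLaw μ t (Set.domRestrict (Set.Iio t) x)) (x t))
termination_by t
decreasing_by exact s.2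

end

end CausalTransport

namespace CausalTransport

/-! ### Quantile functions -/

/-! The cost sees a plan only through the joint laws of the simultaneous increments `(Δx_t, Δy_t)`.
The key fact is that under a causal plan `Δx_t` is independent of `y_1, …, y_{t-1}`: the conditional
law of this past of `y` given `x` is a function of `x_1, …, x_{t-1}`, which is independent of `Δx_t`
(`indepFun_of_mem_causalPlans`). For the equality of values, keep `y` and redraw each `Δx_t`, with
fresh randomness, from its conditional law given `y_1, …, y_t` under the given plan. The laws of
`(Δx_t, Δy_t)` are unchanged, each new `Δx_t` is independent of the past of both processes, so the
first marginal is still `μ` and the plan is causal; in the other direction `x` is built adaptedly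
from `y` and independent noise (`exists_bicausal`, resting on `map_mem_causalPlans`). For
optimality, given the past of `y` the pair `(Δx_t, y_t)` couples the fixed law of `Δx_t` with a
conditional law of `ν`, so each step is a transport problem on the line, solved for convex costs by
the monotone coupling (`ENNConvex.lintegral_sub_le`). The Knothe–Rosenblatt rearrangement uses that
coupling at all steps at once, because quantiles commute with translations
(`lintegral_knotheRosenblatt_le`). For the Monge map, an atomless distribution function inverts its
quantile function, so `T` recovers the driving uniforms from `X*` and sends `X*` to `Y*`. -/

/-- The uniform law on `[0, 1]`. -/
noncomputable abbrev unif : Measure ℝ := (volume : Measure ℝ).restrict (Set.Icc 0 1)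

instance : IsProbabilityMeasure unif := ⟨by simp [unif]⟩

lemma unif_ae_mem_Ioo : ∀ᵐ u ∂unif, u ∈ Set.Ioo (0 : ℝ) 1 := by
  rw [unif, ← restrict_Ioo_eq_restrict_Icc]
  exact ae_restrict_mem measurableSet_Ioo

lemma unif_Iic {a : ℝ} (h1 : a ≤ 1) : unif (Set.Iic a) = ENNReal.ofReal a := by
  rw [unif, Measure.restrict_apply measurableSet_Iic]
  have : Set.Iic a ∩ Set.Icc 0 1 = Set.Icc 0 a := by
    ext x; simp only [Set.mem_inter_iff, Set.mem_Iic, Set.mem_Icc]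
    constructor
    · rintro ⟨h, h', -⟩; exact ⟨h', h⟩
    · rintro ⟨h, h'⟩; exact ⟨h', h, h'.trans h1⟩
  rw [this]; simp

/-- Right continuity of the distribution function makes the infimum attained. Positivity of `u`
bounds the level set below and `hne` makes it nonempty, so `sInf` takes no default value. -/
lemma le_cdf_quantile (η : Measure ℝ) {u : ℝ} (hu : 0 < u) (hne : ∃ y, u ≤ cdf η y) :
    u ≤ cdf η (quantile η u) := by
  have hbdd : BddBelow {y : ℝ | u ≤ cdf η y} := by
    obtain ⟨b, hb⟩ := ((tendsto_cdf_atBot η).eventually (gt_mem_nhds hu)).exists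
    refine ⟨b, fun y hy => le_of_not_gt fun h => ?_⟩
    exact absurd (hy.trans (monotone_cdf η h.le)) (not_le.2 hb)
  have hgt : ∀ y, quantile η u < y → u ≤ cdf η y := by
    intro y hy
    obtain ⟨z, hz, hzy⟩ := exists_lt_of_csInf_lt hne hy
    exact le_trans hz (monotone_cdf η hzy.le)
  have hc := (cdf η).right_continuous (quantile η u)
  refine ge_of_tendsto (hc.mono_left (nhdsWithin_mono _ Set.Ioi_subset_Ici_self)) ?_
  filter_upwards [self_mem_nhdsWithin] with y hy using hgt y hy

lemma quantile_le_iff_of_exists (η : Measure ℝ) {u : ℝ} (hu : 0 < u) (hne : ∃ y, u ≤ cdf η y)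
    (a : ℝ) : quantile η u ≤ a ↔ u ≤ cdf η a := by
  refine ⟨fun h => (le_cdf_quantile η hu hne).trans (monotone_cdf η h), fun h => ?_⟩
  refine csInf_le ?_ h
  obtain ⟨b, hb⟩ := ((tendsto_cdf_atBot η).eventually (gt_mem_nhds hu)).exists
  refine ⟨b, fun y hy => le_of_not_gt fun h => ?_⟩
  exact absurd (hy.trans (monotone_cdf η h.le)) (not_le.2 hb)

lemma exists_le_cdf (η : Measure ℝ) {u : ℝ} (hu : u < 1) : ∃ y, u ≤ cdf η y :=
  (((tendsto_cdf_atTop η).eventually (lt_mem_nhds hu)).exists).imp fun _ h => h.le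

lemma quantile_le_iff (η : Measure ℝ) {u : ℝ} (hu : u ∈ Set.Ioo (0 : ℝ) 1) (a : ℝ) :
    quantile η u ≤ a ↔ u ≤ cdf η a :=
  quantile_le_iff_of_exists η hu.1 (exists_le_cdf η hu.2) a

lemma monotoneOn_quantile (η : Measure ℝ) : MonotoneOn (quantile η) (Set.Ioo 0 1) := by
  intro u hu v hv huv
  rw [quantile_le_iff η hu]
  exact huv.trans ((quantile_le_iff η hv _).1 le_rfl)

/-- The second alternative is an empty level set, where `sInf ∅ = 0`; testing emptiness along the
naturals keeps the description countable, as joint measurability needs. -/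
lemma quantile_le_iff_of_pos (η : Measure ℝ) {u : ℝ} (hu : 0 < u) (a : ℝ) :
    quantile η u ≤ a ↔ u ≤ cdf η a ∨ ((∀ n : ℕ, cdf η n < u) ∧ 0 ≤ a) := by
  by_cases hne : ∃ y, u ≤ cdf η y
  · rw [quantile_le_iff_of_exists η hu hne]
    refine ⟨Or.inl, ?_⟩
    rintro (h | ⟨h, -⟩)
    · exact h
    · obtain ⟨y, hy⟩ := hne
      obtain ⟨n, hn⟩ := exists_nat_ge y
      exact absurd (hy.trans (monotone_cdf η hn)) (not_le.2 (h n))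
  · push Not at hne
    have : quantile η u = 0 := by
      have : {y : ℝ | u ≤ cdf η y} = ∅ := by ext y; simp [hne y]
      rw [quantile, this, Real.sInf_empty]
    rw [this]
    simp [hne]

lemma quantile_of_nonpos (η : Measure ℝ) {u : ℝ} (hu : u ≤ 0) : quantile η u = 0 := by
  have : {y : ℝ | u ≤ cdf η y} = Set.univ := by
    ext y; simpa using hu.trans (cdf_nonneg η y)
  rw [quantile, this, Real.sInf_univ]

/-! ### Joint measurability of quantiles in the level and a parameter -/

section Measurability

variable {α : Type*} [MeasurableSpace α]

lemma measurable_cdf_kernel (κ : Kernel α ℝ) [IsMarkovKernel κ] :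
    Measurable fun p : α × ℝ => cdf (κ p.1) p.2 := by
  have h1 : (fun p : α × ℝ => cdf (κ p.1) p.2) = fun p => (κ p.1 (Set.Iic p.2)).toReal := by
    funext p; rw [cdf_eq_real]; rfl
  rw [h1]
  refine Measurable.ennreal_toReal ?_
  have hs : MeasurableSet {q : (α × ℝ) × ℝ | q.2 ≤ q.1.2} :=
    measurableSet_le measurable_snd (measurable_snd.comp measurable_fst)
  exact Kernel.measurable_kernel_prodMk_left (κ := κ.comap Prod.fst measurable_fst) hs

lemma measurable_quantile_kernel (κ : Kernel α ℝ) [IsMarkovKernel κ] :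
    Measurable fun p : α × ℝ => quantile (κ p.1) p.2 := by
  have hF := measurable_cdf_kernel κ
  have hFc : ∀ y : ℝ, Measurable fun p : α × ℝ => cdf (κ p.1) y := fun y =>
    hF.comp (measurable_fst.prodMk measurable_const)
  refine measurable_of_Iic fun b => ?_
  have : (fun p : α × ℝ => quantile (κ p.1) p.2) ⁻¹' Set.Iic b =
      ({p | 0 < p.2} ∩ ({p | p.2 ≤ cdf (κ p.1) b} ∪
        ((⋂ n : ℕ, {p | cdf (κ p.1) n < p.2}) ∩ {_p | 0 ≤ b}))) ∪
      ({p | p.2 ≤ 0} ∩ {_p | 0 ≤ b}) := by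
    ext p
    simp only [Set.mem_preimage, Set.mem_Iic, Set.mem_union, Set.mem_inter_iff, Set.mem_ofPred_eq,
      Set.mem_iInter]
    rcases lt_or_ge 0 p.2 with h | h
    · rw [quantile_le_iff_of_pos _ h]; simp [h, not_le.2 h]
    · rw [quantile_of_nonpos _ h]; simp [h, not_lt.2 h]
  rw [this]
  have hc : MeasurableSet {_p : α × ℝ | 0 ≤ b} := MeasurableSet.const _
  refine MeasurableSet.union (.inter (measurableSet_lt measurable_const measurable_snd)
    (.union (measurableSet_le measurable_snd (hFc b)) (.inter (.iInter fun n =>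
      measurableSet_lt (hFc n) measurable_snd) hc))) (.inter ?_ hc)
  exact measurableSet_le measurable_snd measurable_const

end Measurability

lemma measurable_quantile (η : Measure ℝ) [IsProbabilityMeasure η] : Measurable (quantile η) :=
  (measurable_quantile_kernel (Kernel.const Unit η)).comp
    (measurable_const.prodMk measurable_id : Measurable fun u : ℝ => ((), u))

lemma map_quantile_unif (η : Measure ℝ) [IsProbabilityMeasure η] : unif.map (quantile η) = η := by
  have hm := measurable_quantile η
  have := Measure.isProbabilityMeasure_map (μ := unif) hm.aemeasurable
  refine Measure.ext_of_Iic _ _ fun a => ?_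
  rw [Measure.map_apply hm measurableSet_Iic, ← ofReal_cdf η a,
    ← unif_Iic (cdf_le_one η a)]
  refine measure_congr ?_
  filter_upwards [unif_ae_mem_Ioo] with u hu
  exact propext (quantile_le_iff η hu a)

/-- Turns quantiles of the conditional laws of `x_t` into quantiles of increments. It fails at
levels `u ≤ 0`, where both quantiles default to 0. -/
lemma quantile_map_add (η : Measure ℝ) [IsProbabilityMeasure η] (s : ℝ) {u : ℝ}
    (hu : u ∈ Set.Ioo (0 : ℝ) 1) : quantile (η.map (· + s)) u = quantile η u + s := by
  have hm : Measurable (fun x : ℝ => x + s) := by fun_prop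
  have := Measure.isProbabilityMeasure_map (μ := η) hm.aemeasurable
  refine eq_of_forall_ge_iff fun a => ?_
  rw [quantile_le_iff _ hu, ← le_sub_iff_add_le, quantile_le_iff _ hu, cdf_eq_real, cdf_eq_real,
    measureReal_def, measureReal_def, Measure.map_apply hm measurableSet_Iic]
  have : (fun x => x + s) ⁻¹' Set.Iic a = Set.Iic (a - s) := by
    ext x; simp [le_sub_iff_add_le]
  rw [this]

/-- Without atoms the distribution function equals its left limit, and to the left of the quantile
it stays below `u`. -/
lemma cdf_quantile (η : Measure ℝ) [IsProbabilityMeasure η] [NullSingletonClass η] {u : ℝ}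
    (hu : u ∈ Set.Ioo (0 : ℝ) 1) : cdf η (quantile η u) = u := by
  refine le_antisymm ?_ ((quantile_le_iff η hu _).1 le_rfl)
  have hlt : ∀ y, y < quantile η u → cdf η y < u := fun y hy => by
    rw [← not_le, quantile_le_iff η hu, not_le] at hy; exact hy
  have h1 : cdf η (quantile η u) = Function.leftLim (cdf η) (quantile η u) := by
    have h := StieltjesFunction.measure_singleton (cdf η) (quantile η u)
    rw [measure_cdf, measure_singleton, eq_comm, ENNReal.ofReal_eq_zero] at h
    exact le_antisymm (by linarith) ((monotone_cdf η).leftLim_le le_rfl)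
  rw [h1]
  refine le_of_tendsto ((monotone_cdf η).tendsto_leftLim (quantile η u)) ?_
  filter_upwards [self_mem_nhdsWithin] with y hy using (hlt y hy).le

/-! ### Optimality of the monotone coupling on the line for convex costs -/

/-- Convexity of a function on the line with values in `[0, ∞]`. -/
def ENNConvex (g : ℝ → ℝ≥0∞) : Prop :=
  ∀ x y a b : ℝ, 0 < a → 0 < b → a + b = 1 →
    g (a * x + b * y) ≤ ENNReal.ofReal a * g x + ENNReal.ofReal b * g y

lemma ENNConvex.comp_neg {g : ℝ → ℝ≥0∞} (hg : ENNConvex g) : ENNConvex fun z => g (-z) := by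
  intro x y a b ha hb hab
  have := hg (-x) (-y) a b ha hb hab
  rwa [show a * -x + b * -y = -(a * x + b * y) by ring] at this

/-- A pointwise maximum of finitely many increasing affine functions and of `0` is a sum of
hinge functions. -/
lemma exists_hinge_sum {ι : Type*} (S : Finset ι) (s k : ι → ℝ) (hs : ∀ i, 0 < s i) :
    ∃ a c : ι → ℝ, (∀ i, 0 ≤ a i) ∧
      (∀ r, 0 ≤ r → (∀ i ∈ S, s i ≤ r) → ∑ i ∈ S, a i ≤ r) ∧
      ∀ z, (S.sup fun i => ENNReal.ofReal (s i * (z - k i))) =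
        ENNReal.ofReal (∑ i ∈ S, a i * max (z - c i) 0) := by
  classical
  -- Hinges are added by increasing slope. The middle conjunct bounds the total slope of the current
  -- sum `f` by `s j`, so the new line minus `f` is nondecreasing.
  induction S using Finset.induction_on_max_value s with
  | empty => exact ⟨0, 0, by simp, by simp, by simp⟩
  | insert j S hj hmax ih =>
    obtain ⟨a, c, ha, hA, hf⟩ := ih
    set f : ℝ → ℝ := fun z => ∑ i ∈ S, a i * max (z - c i) 0 with hfdef
    have hf0 : ∀ z, 0 ≤ f z := fun z =>
      Finset.sum_nonneg fun i _ => mul_nonneg (ha i) (le_max_right _ _)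
    have hsum : ∑ i ∈ S, a i ≤ s j := hA _ (hs j).le hmax
    have hslope : ∀ z w, z ≤ w → f w - f z ≤ s j * (w - z) := by
      intro z w hzw
      have : f w - f z ≤ (∑ i ∈ S, a i) * (w - z) := by
        rw [hfdef, ← Finset.sum_sub_distrib, Finset.sum_mul]
        refine Finset.sum_le_sum fun i _ => ?_
        rw [← mul_sub]
        refine mul_le_mul_of_nonneg_left ?_ (ha i)
        rcases le_total (w - c i) 0 with h | h
        · rw [max_eq_right h]; linarith [le_max_right (z - c i) 0]
        · rw [max_eq_left h]; linarith [le_max_left (z - c i) 0]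
      exact this.trans (mul_le_mul_of_nonneg_right hsum (by linarith))
    have hupd : ∀ (h : ι → ℝ) (v : ℝ), ∀ i ∈ S, Function.update h j v i = h i :=
      fun h v i hi => Function.update_of_ne (ne_of_mem_of_not_mem hi hj) _ _
    by_cases hcross : ∀ z, s j * (z - k j) ≤ f z
    · refine ⟨Function.update a j 0, c, fun i => ?_, fun r hr h => ?_, fun z => ?_⟩
      · by_cases h : i = j
        · subst h; simp
        · simp [h, ha]
      · rw [Finset.sum_insert hj, Function.update_self, zero_add]
        rw [Finset.sum_congr rfl (hupd a 0)]
        exact hA r hr fun i hi => h i (Finset.mem_insert_of_mem hi)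
      · rw [Finset.sup_insert, hf z, Finset.sum_insert hj, Function.update_self, zero_mul, zero_add]
        have e : ∑ i ∈ S, Function.update a j 0 i * max (z - c i) 0 = f z :=
          Finset.sum_congr rfl fun i hi => by rw [hupd _ _ i hi]
        rw [e]
        exact sup_eq_right.2 (ENNReal.ofReal_le_ofReal (hcross z))
    · push Not at hcross
      obtain ⟨z₀, hz₀⟩ := hcross
      have hcont : Continuous fun z => s j * (z - k j) - f z := by
        rw [hfdef]; fun_prop
      -- At `min z₀ (k j)` the line is at most 0, hence at most `f`, while at `z₀` it exceeds `f`.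
      obtain ⟨q, -, hq⟩ : (0 : ℝ) ∈ (fun z => s j * (z - k j) - f z) ''
          Set.Icc (min z₀ (k j)) z₀ := by
        refine intermediate_value_Icc (min_le_left _ _) hcont.continuousOn ⟨?_, by
          simpa using hz₀.le⟩
        have h1 := mul_nonneg (hs j).le (sub_nonneg.2 (min_le_right z₀ (k j)))
        have h2 := hf0 (min z₀ (k j))
        nlinarith
      have hq : f q = s j * (q - k j) := by simp only at hq; linarith
      -- Right of the crossing `q` the new line dominates, so knots there are dropped; the surviving
      -- sum is affine beyond `q`, and a hinge at `q` of weight `s j - ∑ a'` raises its slope to `s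
      -- j`.
      set a' : ι → ℝ := fun i => if c i < q then a i else 0 with ha'
      have ha'0 : ∀ i, 0 ≤ a' i := fun i => by rw [ha']; dsimp only; split_ifs; exacts [ha i, le_rfl]
      have ha'le : ∀ i, a' i ≤ a i := fun i => by
        rw [ha']; dsimp only; split_ifs; exacts [le_rfl, ha i]
      have hA' : ∑ i ∈ S, a' i ≤ s j := (Finset.sum_le_sum fun i _ => ha'le i).trans hsum
      have hleft : ∀ z ≤ q, ∑ i ∈ S, a' i * max (z - c i) 0 = f z := by
        intro z hz
        refine Finset.sum_congr rfl fun i _ => ?_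
        rw [ha']; dsimp only
        split_ifs with h
        · rfl
        · rw [max_eq_right (by linarith), mul_zero, mul_zero]
      have hright : ∀ z, q ≤ z → ∑ i ∈ S, a' i * max (z - c i) 0 =
          f q + (∑ i ∈ S, a' i) * (z - q) := by
        intro z hz
        rw [← hleft q le_rfl, Finset.sum_mul, ← Finset.sum_add_distrib]
        refine Finset.sum_congr rfl fun i _ => ?_
        rw [ha']; dsimp only
        split_ifs with h
        · rw [max_eq_left (by linarith), max_eq_left (by linarith)]; ring
        · simp
      refine ⟨Function.update a' j (s j - ∑ i ∈ S, a' i), Function.update c j q, fun i => ?_,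
        fun r hr h => ?_, fun z => ?_⟩
      · by_cases h : i = j
        · subst h; simpa using hA'
        · simp [h, ha'0]
      · rw [Finset.sum_insert hj, Function.update_self, Finset.sum_congr rfl (hupd a' _)]
        simpa using h j (Finset.mem_insert_self _ _)
      · rw [Finset.sup_insert, hf z, Finset.sum_insert hj, Function.update_self,
          Function.update_self]
        have e : ∑ i ∈ S, Function.update a' j (s j - ∑ i ∈ S, a' i) i *
            max (z - Function.update c j q i) 0 = ∑ i ∈ S, a' i * max (z - c i) 0 :=
          Finset.sum_congr rfl fun i hi => by rw [hupd _ _ i hi, hupd _ _ i hi]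
        rw [e]
        rcases le_total z q with hz | hz
        · rw [hleft z hz, max_eq_right (sub_nonpos.2 hz), mul_zero, zero_add]
          refine sup_eq_right.2 (ENNReal.ofReal_le_ofReal ?_)
          have := hslope z q hz
          nlinarith
        · rw [hright z hz, max_eq_left (sub_nonneg.2 hz)]
          have h1 := hslope q z hz
          have h2 : f z ≤ s j * (z - k j) := by nlinarith
          rw [sup_eq_left.2 (ENNReal.ofReal_le_ofReal h2)]
          congr 1
          rw [hq]; ring

/-- A convex lower semicontinuous function that is larger than `m + r` to the right of a point at
which it is smaller has an increasing affine minorant with that value. -/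
lemma ENNConvex.exists_hinge_le {g : ℝ → ℝ≥0∞} (hg : ENNConvex g) (hlsc : LowerSemicontinuous g)
    {m : ℝ≥0∞} (hm : m ≠ ⊤) (hmg : ∀ z, m ≤ g z) {p z₀ r : ℝ} (hp : p < z₀) (hr : 0 < r)
    (hz₀ : m + ENNReal.ofReal r < g z₀) (hgp : g p < m + ENNReal.ofReal r) :
    ∃ s k : ℝ, 0 < s ∧ s * (z₀ - k) = r ∧ ∀ z, m + ENNReal.ofReal (s * (z - k)) ≤ g z := by
  set v : ℝ → ℝ := fun z => (g z).toReal - m.toReal with hv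
  have hv0 : ∀ z, g z ≠ ⊤ → 0 ≤ v z := fun z hz =>
    sub_nonneg.2 (ENNReal.toReal_mono hz (hmg z))
  have hgv : ∀ z, g z ≠ ⊤ → g z = m + ENNReal.ofReal (v z) := by
    intro z hz
    rw [hv, ENNReal.ofReal_sub _ ENNReal.toReal_nonneg, ENNReal.ofReal_toReal hz,
      ENNReal.ofReal_toReal hm, add_tsub_cancel_of_le (hmg z)]
  have hlt : ∀ z, g z ≠ ⊤ → m + ENNReal.ofReal r < g z → r < v z := by
    intro z hz h
    rw [hgv z hz, ENNReal.add_lt_add_iff_left hm] at h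
    exact (ENNReal.ofReal_lt_ofReal_iff_of_nonneg hr.le).1 h
  have hptop : g p ≠ ⊤ := ne_top_of_lt hgp
  have hvp : v p < r := by
    rw [hgv p hptop, ENNReal.add_lt_add_iff_left hm] at hgp
    exact (ENNReal.ofReal_lt_ofReal_iff hr).1 hgp
  -- The point `(z₀, m + r)` lies strictly below the graph, so slopes from graph points on its left
  -- are at most slopes to graph points on its right. The slope sought is the supremum of the
  -- former.
  have hsec : ∀ z₁ z₂, z₁ < z₀ → z₀ < z₂ → g z₁ ≠ ⊤ → g z₂ ≠ ⊤ →
      (r - v z₁) / (z₀ - z₁) ≤ (v z₂ - r) / (z₂ - z₀) := by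
    intro z₁ z₂ h1 h2 ht1 ht2
    have hd : 0 < z₂ - z₁ := by linarith
    set a := (z₂ - z₀) / (z₂ - z₁)
    set b := (z₀ - z₁) / (z₂ - z₁)
    have ha : 0 < a := div_pos (by linarith) hd
    have hb : 0 < b := div_pos (by linarith) hd
    have hab : a + b = 1 := by simp only [a, b]; field_simp; ring
    have hz : a * z₁ + b * z₂ = z₀ := by simp only [a, b]; field_simp; ring
    have h := hg z₁ z₂ a b ha hb hab
    rw [hz, hgv z₁ ht1, hgv z₂ ht2] at h
    have h' : m + ENNReal.ofReal r < m + ENNReal.ofReal (a * v z₁ + b * v z₂) := by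
      refine (hz₀.trans_le h).trans_eq ?_
      rw [mul_add, mul_add, ← ENNReal.ofReal_mul ha.le, ← ENNReal.ofReal_mul hb.le,
        add_add_add_comm, ← add_mul, ← ENNReal.ofReal_add ha.le hb.le, hab, ENNReal.ofReal_one,
        one_mul, ENNReal.ofReal_add (mul_nonneg ha.le (hv0 _ ht1)) (mul_nonneg hb.le (hv0 _ ht2))]
    rw [ENNReal.add_lt_add_iff_left hm, ENNReal.ofReal_lt_ofReal_iff_of_nonneg hr.le] at h'
    rw [div_le_div_iff₀ (by linarith) (by linarith)]
    have h3 : r * (z₂ - z₁) < (z₂ - z₀) * v z₁ + (z₀ - z₁) * v z₂ := by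
      have := mul_lt_mul_of_pos_right h' hd
      have e : (a * v z₁ + b * v z₂) * (z₂ - z₁) = (z₂ - z₀) * v z₁ + (z₀ - z₁) * v z₂ := by
        simp only [a, b]; field_simp
      linarith
    nlinarith
  -- Lower semicontinuity bounds the left slopes: within `δ` of `z₀` they are nonpositive, further
  -- away at most `r / δ`. The right slopes cannot serve as bounds, since `g` may be infinite to the
  -- right of `z₀`.
  obtain ⟨δ, hδ, hball⟩ := Metric.eventually_nhds_iff.1 (hlsc z₀ _ hz₀)
  set A : Set ℝ := {t | ∃ z < z₀, g z ≠ ⊤ ∧ t = (r - v z) / (z₀ - z)} with hA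
  have hbdd : BddAbove A := by
    refine ⟨r / δ, ?_⟩
    rintro t ⟨z, hz, ht, rfl⟩
    rcases lt_or_ge (z₀ - z) δ with h | h
    · have := hlt z ht (hball (by rw [Real.dist_eq, abs_sub_comm, abs_of_pos] <;> linarith))
      exact (div_nonpos_of_nonpos_of_nonneg (by linarith) (by linarith)).trans
        (div_nonneg hr.le hδ.le)
    · exact div_le_div₀ hr.le (by linarith [hv0 z ht]) hδ h
  have hpA : (r - v p) / (z₀ - p) ∈ A := ⟨p, hp, hptop, rfl⟩
  set s := sSup A with hs
  have hspos : 0 < s := (div_pos (by linarith) (by linarith)).trans_le (le_csSup hbdd hpA)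
  have hk : ∀ z, s * (z - (z₀ - r / s)) = r + s * (z - z₀) := by
    intro z; field_simp; ring
  refine ⟨s, z₀ - r / s, hspos, by rw [hk]; ring, fun z => ?_⟩
  rw [hk]
  by_cases hz : g z = ⊤
  · rw [hz]; exact le_top
  rw [hgv z hz]
  refine add_le_add le_rfl (ENNReal.ofReal_le_ofReal ?_)
  rcases lt_trichotomy z z₀ with h | h | h
  · have := le_csSup hbdd (show (r - v z) / (z₀ - z) ∈ A from ⟨z, h, hz, rfl⟩)
    rw [← hs, div_le_iff₀ (by linarith)] at this
    linarith
  · subst h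
    have := hlt z hz hz₀
    linarith
  · have : s ≤ (v z - r) / (z - z₀) := by
      refine csSup_le ⟨_, hpA⟩ ?_
      rintro t ⟨w, hw, ht, rfl⟩
      exact hsec w z hw h ht hz
    rw [le_div_iff₀ (by linarith)] at this
    linarith

/-- The rational increasing hinges that lie below `g - m`. -/
abbrev HingeBelow (g : ℝ → ℝ≥0∞) (m : ℝ≥0∞) : Type :=
  {p : ℚ × ℚ // 0 < p.1 ∧ ∀ z : ℝ, m + ENNReal.ofReal ((p.1 : ℝ) * (z - (p.2 : ℝ))) ≤ g z}

/-- The supremum of the increasing hinges that lie below `g - m`. -/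
noncomputable def hingeSup (g : ℝ → ℝ≥0∞) (m : ℝ≥0∞) (z : ℝ) : ℝ≥0∞ :=
  ⨆ i : HingeBelow g m, ENNReal.ofReal ((i.1.1 : ℝ) * (z - (i.1.2 : ℝ)))

lemma measurable_hingeSup (g : ℝ → ℝ≥0∞) (m : ℝ≥0∞) : Measurable (hingeSup g m) :=
  Measurable.iSup fun i => by fun_prop

lemma add_hingeSup_le {g : ℝ → ℝ≥0∞} {m : ℝ≥0∞} (hm : m ≠ ⊤) (hmg : ∀ z, m ≤ g z) (z : ℝ) :
    m + hingeSup g m z ≤ g z := by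
  have : hingeSup g m z ≤ g z - m :=
    iSup_le fun i => ENNReal.le_sub_of_add_le_left hm (i.2.2 z)
  calc m + hingeSup g m z ≤ m + (g z - m) := add_le_add le_rfl this
    _ = g z := add_tsub_cancel_of_le (hmg z)

/-- The gap between `r'` and `r` leaves room to move the knot right and lower the slope to rational
values; both moves keep the hinge below `g - m`. Rational parameters make the supremum countable. -/
lemma ENNConvex.le_hingeSup {g : ℝ → ℝ≥0∞} (hg : ENNConvex g) (hlsc : LowerSemicontinuous g)
    {m : ℝ≥0∞} (hm : m ≠ ⊤) (hmg : ∀ z, m ≤ g z) {p z₀ r r' : ℝ} (hp : p < z₀) (hr : 0 < r)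
    (hz₀ : m + ENNReal.ofReal r < g z₀) (hgp : g p < m + ENNReal.ofReal r) (h0 : 0 < r')
    (hr' : r' < r) : ENNReal.ofReal r' ≤ hingeSup g m z₀ := by
  obtain ⟨s, k, hs, hsk, hle⟩ := hg.exists_hinge_le hlsc hm hmg hp hr hz₀ hgp
  obtain ⟨k', hk1, hk2⟩ := exists_rat_btwn (show k < z₀ - r' / s by
    have : r' / s < z₀ - k := by rw [div_lt_iff₀ hs]; linarith
    linarith)
  have hd : 0 < z₀ - k' := by have := div_pos h0 hs; linarith
  obtain ⟨s', hs1, hs2⟩ := exists_rat_btwn (show r' / (z₀ - k') < s by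
    rw [div_lt_iff₀ hd]
    have : r' / s < z₀ - k' := by linarith
    rw [div_lt_iff₀ hs] at this
    linarith)
  have hs'0 : (0 : ℝ) < s' := (div_pos h0 hd).trans hs1
  refine le_trans ?_ (le_iSup (fun i : HingeBelow g m =>
    ENNReal.ofReal ((i.1.1 : ℝ) * (z₀ - (i.1.2 : ℝ)))) ⟨(s', k'), by exact_mod_cast hs'0,
      fun z => le_trans ?_ (hle z)⟩)
  · refine ENNReal.ofReal_le_ofReal ?_
    rw [div_lt_iff₀ hd] at hs1
    exact hs1.le
  · refine add_le_add le_rfl ?_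
    dsimp only
    rcases le_total z k' with h | h
    · rw [ENNReal.ofReal_of_nonpos (mul_nonpos_of_nonneg_of_nonpos hs'0.le (by linarith))]
      exact zero_le
    · refine ENNReal.ofReal_le_ofReal (mul_le_mul hs2.le (by linarith) (by linarith) hs.le)

/-- A convex lower semicontinuous function is the sum of its infimum, an increasing and a
decreasing supremum of hinges. -/
lemma ENNConvex.eq_add_hingeSup {g : ℝ → ℝ≥0∞} (hg : ENNConvex g) (hlsc : LowerSemicontinuous g)
    (hm : ⨅ z, g z ≠ ⊤) (z : ℝ) :
    g z = (⨅ z, g z) + hingeSup g (⨅ z, g z) z + hingeSup (fun z => g (-z)) (⨅ z, g z) (-z) := by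
  set m := ⨅ z, g z with hmdef
  have hmg : ∀ z, m ≤ g z := fun z => iInf_le _ z
  have hlsc' : LowerSemicontinuous fun z => g (-z) := hlsc.comp continuous_neg
  refine le_antisymm ?_ ?_
  · refine le_of_forall_lt fun b hb => ?_
    obtain ⟨b', hbb', hb'⟩ := exists_between hb
    rcases le_or_gt b' m with h | h
    · exact (hbb'.trans_le h).trans_le (by rw [add_assoc]; exact le_self_add)
    obtain ⟨d, hd, hdg⟩ := exists_between hb'
    have hdtop : d ≠ ⊤ := ne_top_of_lt hdg
    have hb'top : b' ≠ ⊤ := ne_top_of_lt hd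
    have hreal : ∀ e, e ≠ ⊤ → m < e → m + ENNReal.ofReal (e.toReal - m.toReal) = e := by
      intro e he hme
      rw [ENNReal.ofReal_sub _ ENNReal.toReal_nonneg, ENNReal.ofReal_toReal he,
        ENNReal.ofReal_toReal hm, add_tsub_cancel_of_le hme.le]
    have hmr : m.toReal < b'.toReal := (ENNReal.toReal_lt_toReal hm hb'top).2 h
    have hbd : b'.toReal < d.toReal := (ENNReal.toReal_lt_toReal hb'top hdtop).2 hd
    have hz₀ : m + ENNReal.ofReal (d.toReal - m.toReal) < g z := by
      rw [hreal d hdtop (h.trans hd)]; exact hdg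
    obtain ⟨p, hp⟩ : ∃ p, g p < m + ENNReal.ofReal (d.toReal - m.toReal) := by
      rw [hreal d hdtop (h.trans hd)]; exact iInf_lt_iff.1 (h.trans hd)
    refine hbb'.trans_le ?_
    rw [← hreal b' hb'top h, add_assoc]
    refine add_le_add le_rfl ?_
    -- The side of `z` on which `g` takes the smaller value decides whether the increasing or the
    -- decreasing hinges reach the level.
    rcases lt_trichotomy p z with h1 | h1 | h1
    · exact (hg.le_hingeSup hlsc hm hmg h1 (by linarith) hz₀ hp (by linarith)
        (by linarith)).trans le_self_add
    · subst h1; exact absurd hp hz₀.not_gt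
    · exact (hg.comp_neg.le_hingeSup hlsc' hm (fun z => hmg (-z)) (neg_lt_neg h1)
        (r := d.toReal - m.toReal) (by linarith) (by simpa using hz₀) (by simpa using hp)
        (by linarith) (by linarith)).trans le_add_self
  -- An increasing and a decreasing hinge both positive at `z` would together keep `g` above `m + ε`
  -- on the whole line, against the choice of `m` as infimum.
  · have key : hingeSup g m z = 0 ∨ hingeSup (fun z => g (-z)) m (-z) = 0 := by
      by_contra! hcon
      simp only [hingeSup, ne_eq, ENNReal.iSup_eq_zero, not_forall, ENNReal.ofReal_eq_zero, not_le] at hcon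
      obtain ⟨⟨⟨⟨s, k⟩, hs, hi⟩, hi0⟩, ⟨⟨⟨t, l⟩, ht, hj⟩, hj0⟩⟩ := hcon
      simp only at hs ht hi0 hj0 hi hj
      have hs' : (0 : ℝ) < s := by exact_mod_cast hs
      have ht' : (0 : ℝ) < t := by exact_mod_cast ht
      set ε := min ((s : ℝ) * (z - k)) ((t : ℝ) * (-z - l)) with hε
      have hε0 : 0 < ε := lt_min hi0 hj0
      have : m + ENNReal.ofReal ε ≤ m := by
        conv_rhs => rw [hmdef]
        refine le_iInf fun w => ?_
        rcases le_total z w with h | h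
        · refine le_trans (add_le_add le_rfl (ENNReal.ofReal_le_ofReal ?_)) (hi w)
          exact (min_le_left _ _).trans (mul_le_mul_of_nonneg_left (by linarith) hs'.le)
        · have := hj (-w)
          rw [neg_neg] at this
          refine le_trans (add_le_add le_rfl (ENNReal.ofReal_le_ofReal ?_)) this
          exact (min_le_right _ _).trans (mul_le_mul_of_nonneg_left (by linarith) ht'.le)
      refine absurd this (not_le.2 (ENNReal.lt_add_right hm ?_))
      simpa using hε0
    rcases key with h | h
    · rw [h, add_zero]
      have := add_hingeSup_le (g := fun z => g (-z)) hm (fun z => hmg (-z)) (-z)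
      simpa using this
    · rw [h, add_zero]
      exact add_hingeSup_le hm hmg z

/-! ### Comparison of couplings, from one hinge to convex costs -/

section Coupling

variable {Ω : Type*} [MeasurableSpace Ω] {P : Measure Ω} [IsProbabilityMeasure P]
  {X Y : Ω → ℝ} {F G : ℝ → ℝ}

/-- The positive part of `X - Y - k` is the length of the interval `(Y + k, X]`; Tonelli exchanges
length and probability. -/
lemma lintegral_ofReal_sub {Ω : Type*} [MeasurableSpace Ω] (P : Measure Ω) [SFinite P]
    {X Y : Ω → ℝ} (hX : Measurable X) (hY : Measurable Y) (k : ℝ) :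
    ∫⁻ ω, ENNReal.ofReal (X ω - Y ω - k) ∂P = ∫⁻ t, P {ω | Y ω + k < t ∧ t ≤ X ω} := by
  have hs : MeasurableSet {p : Ω × ℝ | Y p.1 + k < p.2 ∧ p.2 ≤ X p.1} :=
    (measurableSet_lt (f := fun p : Ω × ℝ => Y p.1 + k) (g := Prod.snd)
      (by fun_prop) (by fun_prop)).inter
    (measurableSet_le (f := Prod.snd) (g := fun p : Ω × ℝ => X p.1) (by fun_prop) (by fun_prop))
  have h1 := Measure.prod_apply (μ := P) (ν := (volume : Measure ℝ)) hs
  have h2 := Measure.prod_apply_symm (μ := P) (ν := (volume : Measure ℝ)) hs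
  rw [h1] at h2
  rw [show (∫⁻ t, P {ω | Y ω + k < t ∧ t ≤ X ω}) =
    ∫⁻ t, P ((fun ω => (ω, t)) ⁻¹' {p : Ω × ℝ | Y p.1 + k < p.2 ∧ p.2 ≤ X p.1}) from rfl, ← h2]
  refine lintegral_congr fun ω => ?_
  have : Prod.mk ω ⁻¹' {p : Ω × ℝ | Y p.1 + k < p.2 ∧ p.2 ≤ X p.1} = Set.Ioc (Y ω + k) (X ω) := rfl
  rw [this, Real.volume_Ioc]
  congr 1; ring

/-- At each level `t` the event is `{Y + k < t} \ {X < t}`, of probability at least the difference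
of two numbers fixed by the marginals. For monotone `F` and `G` the two events are nested up to a
null set, so the difference, or 0 if it is negative, is attained. -/
lemma lintegral_hinge_le (hX : Measurable X) (hY : Measurable Y) (hF : Measurable F)
    (hG : Measurable G) (mF : MonotoneOn F (Set.Ioo 0 1)) (mG : MonotoneOn G (Set.Ioo 0 1))
    (hXF : unif.map F = P.map X) (hYG : unif.map G = P.map Y) {s : ℝ} (hs : 0 ≤ s) (k : ℝ) :
    ∫⁻ u, ENNReal.ofReal (s * (F u - G u - k)) ∂unif ≤
      ∫⁻ ω, ENNReal.ofReal (s * (X ω - Y ω - k)) ∂P := by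
  simp_rw [ENNReal.ofReal_mul hs]
  rw [lintegral_const_mul _ (by fun_prop), lintegral_const_mul _ (by fun_prop)]
  refine mul_le_mul_right ?_ _
  rw [lintegral_ofReal_sub _ hF hG, lintegral_ofReal_sub _ hX hY]
  refine lintegral_mono fun t => ?_
  have hF' : unif {u | F u < t} = P {ω | X ω < t} := by
    have := congrArg (fun m => m (Set.Iio t)) hXF
    simp only [Measure.map_apply hF measurableSet_Iio,
      Measure.map_apply hX measurableSet_Iio] at this
    exact this
  have hG' : unif {u | G u + k < t} = P {ω | Y ω + k < t} := by
    have := congrArg (fun m => m (Set.Iio (t - k))) hYG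
    simp only [Measure.map_apply hG measurableSet_Iio,
      Measure.map_apply hY measurableSet_Iio] at this
    convert this using 2 <;>
    · ext; simp [lt_sub_iff_add_lt]
  have mFt : MeasurableSet {u | F u < t} := measurableSet_lt hF measurable_const
  have e1 : {u | G u + k < t ∧ t ≤ F u} = {u | G u + k < t} \ {u | F u < t} := by
    ext u; simp
  have e2 : {ω | Y ω + k < t ∧ t ≤ X ω} = {ω | Y ω + k < t} \ {ω | X ω < t} := by
    ext u; simp
  rw [e1, e2]
  refine le_trans ?_ (le_measure_sdiff)
  rw [← hF', ← hG']
  by_cases h : ∃ u ∈ Set.Ioo (0 : ℝ) 1, G u + k < t ∧ t ≤ F u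
  · obtain ⟨u₀, hu₀, h1, h2⟩ := h
    have hsub : {u | F u < t} ≤ᵐ[unif] {u | G u + k < t} := by
      filter_upwards [unif_ae_mem_Ioo] with u hu hFu
      have hFu : F u < t := hFu
      have : u ≤ u₀ := by
        by_contra! hlt
        exact absurd (h2.trans (mF hu₀ hu hlt.le)) (not_le.2 hFu)
      exact (add_le_add_left (mG hu hu₀ this) k).trans_lt h1
    rw [← measure_sdiff_add_inter (μ := unif) {u | G u + k < t} mFt]
    refine ENNReal.le_sub_of_add_le_right (measure_ne_top _ _) ?_
    refine add_le_add le_rfl (measure_mono_ae ?_)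
    filter_upwards [hsub] with u hu h using ⟨hu h, h⟩
  · push Not at h
    have : unif ({u | G u + k < t} \ {u | F u < t}) = 0 := by
      rw [← e1]
      refine measure_mono_null (t := (Set.Ioo (0 : ℝ) 1)ᶜ) ?_ (mem_ae_iff.1 unif_ae_mem_Ioo)
      rintro u ⟨h1, h2⟩ hu
      exact absurd h2 (not_le.2 (h u hu h1))
    rw [this]; exact zero_le

/-- The supremum is a countable directed one over finite sets of hinges, so monotone convergence
applies; each finite maximum is a sum of hinges, to which the one-hinge bound applies term by term.
-/
lemma lintegral_hingeSup_le (hX : Measurable X) (hY : Measurable Y) (hF : Measurable F)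
    (hG : Measurable G) (mF : MonotoneOn F (Set.Ioo 0 1)) (mG : MonotoneOn G (Set.Ioo 0 1))
    (hXF : unif.map F = P.map X) (hYG : unif.map G = P.map Y) (g : ℝ → ℝ≥0∞) (m : ℝ≥0∞) :
    ∫⁻ u, hingeSup g m (F u - G u) ∂unif ≤ ∫⁻ ω, hingeSup g m (X ω - Y ω) ∂P := by
  have hsup : ∀ z, hingeSup g m z = ⨆ S : Finset (HingeBelow g m),
      S.sup fun i => ENNReal.ofReal ((i.1.1 : ℝ) * (z - (i.1.2 : ℝ))) := by
    intro z
    simp_rw [Finset.sup_eq_iSup]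
    exact iSup_eq_iSup_finset _
  have hmS : ∀ S : Finset (HingeBelow g m), Measurable fun z : ℝ =>
      S.sup fun i => ENNReal.ofReal ((i.1.1 : ℝ) * (z - (i.1.2 : ℝ))) := by
    intro S
    simp_rw [Finset.sup_eq_iSup]
    exact Measurable.iSup fun i => Measurable.iSup fun _ => by fun_prop
  simp_rw [hsup]
  rw [lintegral_iSup_directed_of_measurable (f := fun (S : Finset (HingeBelow g m)) u =>
    S.sup fun i => ENNReal.ofReal ((i.1.1 : ℝ) * (F u - G u - (i.1.2 : ℝ))))
    (fun S => (hmS S).comp (hF.sub hG))]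
  · refine iSup_le fun S => ?_
    refine le_trans ?_ (lintegral_mono fun ω => le_iSup (fun S : Finset (HingeBelow g m) =>
      S.sup fun i => ENNReal.ofReal ((i.1.1 : ℝ) * (X ω - Y ω - (i.1.2 : ℝ)))) S)
    obtain ⟨a, c, ha, -, hac⟩ := exists_hinge_sum S (fun i => (i.1.1 : ℝ)) (fun i => (i.1.2 : ℝ))
      (fun i => by exact_mod_cast i.2.1)
    have hac' : ∀ z : ℝ, (S.sup fun i => ENNReal.ofReal ((i.1.1 : ℝ) * (z - (i.1.2 : ℝ)))) =
        ∑ i ∈ S, ENNReal.ofReal (a i * (z - c i)) := by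
      intro z
      rw [hac z, ENNReal.ofReal_sum_of_nonneg fun i _ => mul_nonneg (ha i) (le_max_right _ _)]
      refine Finset.sum_congr rfl fun i _ => ?_
      rcases le_total (z - c i) 0 with h | h
      · rw [max_eq_right h, mul_zero, ENNReal.ofReal_zero, ENNReal.ofReal_of_nonpos
          (mul_nonpos_of_nonneg_of_nonpos (ha i) h)]
      · rw [max_eq_left h]
    simp_rw [hac']
    rw [lintegral_finsetSum _ fun i _ => by fun_prop, lintegral_finsetSum _ fun i _ => by fun_prop]
    exact Finset.sum_le_sum fun i _ => lintegral_hinge_le hX hY hF hG mF mG hXF hYG (ha i) _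
  · intro S T
    classical
    exact ⟨S ∪ T, fun u => Finset.sup_mono Finset.subset_union_left,
      fun u => Finset.sup_mono Finset.subset_union_right⟩

/-- The monotone coupling is optimal among all couplings for a convex cost. -/
lemma ENNConvex.lintegral_sub_le {g : ℝ → ℝ≥0∞} (hg : ENNConvex g)
    (hlsc : LowerSemicontinuous g) (hX : Measurable X) (hY : Measurable Y) (hF : Measurable F)
    (hG : Measurable G) (mF : MonotoneOn F (Set.Ioo 0 1)) (mG : MonotoneOn G (Set.Ioo 0 1))
    (hXF : unif.map F = P.map X) (hYG : unif.map G = P.map Y) :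
    ∫⁻ u, g (F u - G u) ∂unif ≤ ∫⁻ ω, g (X ω - Y ω) ∂P := by
  by_cases hm : ⨅ z, g z = ⊤
  · have : ∀ z, g z = ⊤ := fun z => iInf_eq_top.1 hm z
    simp [this]
  have h1 := measurable_hingeSup g (⨅ z, g z)
  have h2 := measurable_hingeSup (fun z => g (-z)) (⨅ z, g z)
  have hd : ∀ z, g z = (⨅ z, g z) + hingeSup g (⨅ z, g z) z +
    hingeSup (fun z => g (-z)) (⨅ z, g z) (-z) := hg.eq_add_hingeSup hlsc hm
  rw [lintegral_congr fun u => hd (F u - G u), lintegral_congr fun ω => hd (X ω - Y ω)]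
  rw [lintegral_add_right _ (by fun_prop), lintegral_add_right _ (by fun_prop),
    lintegral_add_left (by fun_prop), lintegral_add_left (by fun_prop)]
  simp only [lintegral_const, measure_univ, neg_sub]
  gcongr ?_ + ?_ + ?_
  · exact le_rfl
  · exact lintegral_hingeSup_le hX hY hF hG mF mG hXF hYG _ _
  -- The decreasing part is an increasing function of `Y - X`, so the two variables exchange roles.
  · exact lintegral_hingeSup_le hY hX hG hF mG mF hYG hXF _ _

end Coupling

/-! ### Truncated paths and increments -/

/-- The part of a path strictly before time `t`. -/
abbrev past {n : ℕ} (t : Fin n) (x : Path n) : Set.Iio t → ℝ := Set.domRestrict (Set.Iio t) x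

/-- Extension by zero of a path known strictly before time `t`. -/
def extend {n : ℕ} (t : Fin n) (w : Set.Iio t → ℝ) : Path n :=
  fun s => if h : s < t then w ⟨s, h⟩ else 0

lemma extend_past_apply {n : ℕ} {t s : Fin n} (h : s < t) (x : Path n) :
    extend t (past t x) s = x s := by
  simp [extend, past, h]

@[fun_prop]
lemma measurable_extend {n : ℕ} (t : Fin n) : Measurable (extend t) := by
  refine measurable_pi_iff.2 fun s => ?_
  by_cases h : s < t
  · simp only [extend, h, dite_true]; fun_prop
  · simp only [extend, h, dite_false]; fun_prop

@[fun_prop]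
lemma measurable_past {n : ℕ} (t : Fin n) : Measurable (past t) :=
  measurable_pi_iff.2 fun s => measurable_pi_apply s.1

lemma past_congr {n : ℕ} {t : Fin n} {x y : Path n} (h : ∀ s < t, x s = y s) :
    past t x = past t y := funext fun s => h s.1 s.2

/-- The value just before time `t`, and `0` at the initial time. -/
def prev {N : ℕ} (t : Fin (N + 1)) (w : Set.Iio t → ℝ) : ℝ :=
  if h : 0 < t then w ⟨⟨t.1 - 1, by omega⟩, by
    rw [Set.mem_Iio, Fin.lt_def]
    have : 0 < t.1 := h
    simp only; omega⟩ else 0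

@[fun_prop]
lemma measurable_prev {N : ℕ} (t : Fin (N + 1)) : Measurable (prev t) := by
  unfold prev
  by_cases h : 0 < t
  · simp only [h, dite_true]; fun_prop
  · simp only [h, dite_false]; fun_prop

lemma incr_eq_sub_prev {N : ℕ} (x : Path (N + 1)) (t : Fin (N + 1)) :
    incr x t = x t - prev t (past t x) := by
  refine Fin.cases ?_ (fun i => ?_) t
  · simp [incr, prev]
  · simp only [incr, Fin.cons_succ, prev, Fin.succ_pos, dite_true, past, Set.domRestrict_apply]
    rfl

@[fun_prop]
lemma measurable_incr {N : ℕ} : Measurable (incr : Path (N + 1) → Path (N + 1)) := by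
  refine measurable_pi_iff.2 fun t => ?_
  simp_rw [incr_eq_sub_prev]
  fun_prop

@[fun_prop]
lemma measurable_incr_apply {N : ℕ} (t : Fin (N + 1)) :
    Measurable fun x : Path (N + 1) => incr x t := measurable_pi_iff.1 measurable_incr t

/-- The path with given increments. -/
def cumsum {N : ℕ} (d : Path (N + 1)) : Path (N + 1) := fun t => ∑ s ∈ Finset.Iic t, d s

@[fun_prop]
lemma measurable_cumsum {N : ℕ} : Measurable (cumsum : Path (N + 1) → Path (N + 1)) :=
  measurable_pi_iff.2 fun t => by unfold cumsum; fun_prop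

lemma cumsum_congr {N : ℕ} {t : Fin (N + 1)} {d e : Path (N + 1)} (h : ∀ s ≤ t, d s = e s) :
    cumsum d t = cumsum e t :=
  Finset.sum_congr rfl fun s hs => h s (Finset.mem_Iic.1 hs)

lemma cumsum_zero {N : ℕ} (d : Path (N + 1)) : cumsum d 0 = d 0 := by
  have : Finset.Iic (0 : Fin (N + 1)) = {0} := by
    ext s; simp
  simp [cumsum, this]

lemma cumsum_succ {N : ℕ} (d : Path (N + 1)) (i : Fin N) :
    cumsum d i.succ = cumsum d i.castSucc + d i.succ := by
  have : Finset.Iic i.succ = insert i.succ (Finset.Iic i.castSucc) := by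
    ext s; simp only [Finset.mem_Iic, Finset.mem_insert, Fin.le_def, Fin.ext_iff, Fin.val_succ,
      Fin.val_castSucc]; omega
  rw [cumsum, this, Finset.sum_insert (by simp [Fin.le_def]), add_comm]
  rfl

lemma incr_cumsum {N : ℕ} (d : Path (N + 1)) : incr (cumsum d) = d := by
  funext t
  refine Fin.cases ?_ (fun i => ?_) t
  · simp [incr, cumsum_zero]
  · simp [incr, cumsum_succ]

lemma eq_cumsum_of_incr_eq {N : ℕ} {x d : Path (N + 1)} (h : incr x = d) : x = cumsum d := by
  funext t
  induction t using Fin.induction with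
  | zero => rw [cumsum_zero, ← h]; simp [incr]
  | succ i ih => rw [cumsum_succ, ← ih, ← h]; simp [incr]

lemma cumsum_incr {N : ℕ} (x : Path (N + 1)) : cumsum (incr x) = x :=
  (eq_cumsum_of_incr_eq rfl).symm

lemma incr_congr {N : ℕ} {t : Fin (N + 1)} {x y : Path (N + 1)} (h : ∀ s ≤ t, x s = y s) :
    incr x t = incr y t := by
  rw [incr_eq_sub_prev, incr_eq_sub_prev, h t le_rfl, past_congr fun s hs => h s hs.le]

/-! ### Randomization by quantiles -/

section Randomization

variable {Ω α : Type*} [MeasurableSpace Ω] [MeasurableSpace α] {P : Measure Ω}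
  [IsProbabilityMeasure P]

/-- An independent uniform variable realises any kernel to the line. This serves both the quantile
transform and the redrawing of increments in the bicausal plan. -/
lemma map_prodMk_quantile {Z : Ω → α} {V : Ω → ℝ} (hZ : Measurable Z) (hV : Measurable V)
    (hind : IndepFun Z V P) (hunif : P.map V = unif) (κ : Kernel α ℝ) [IsMarkovKernel κ] :
    P.map (fun ω => (Z ω, quantile (κ (Z ω)) (V ω))) = (P.map Z) ⊗ₘ κ := by
  have hprod := (indepFun_iff_map_prod_eq_prod_map_map hZ.aemeasurable hV.aemeasurable).1 hind
  rw [hunif] at hprod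
  have hq := measurable_quantile_kernel κ
  have hm : Measurable fun p : α × ℝ => (p.1, quantile (κ p.1) p.2) := measurable_fst.prodMk hq
  have : P.map (fun ω => (Z ω, quantile (κ (Z ω)) (V ω))) =
      ((P.map Z).prod unif).map fun p : α × ℝ => (p.1, quantile (κ p.1) p.2) := by
    rw [← hprod, Measure.map_map hm (hZ.prodMk hV)]; rfl
  rw [this]
  have := Measure.isProbabilityMeasure_map (μ := P) hZ.aemeasurable
  ext s hs
  rw [Measure.map_apply hm hs, Measure.prod_apply (hm hs), Measure.compProd_apply hs]
  refine lintegral_congr fun z => ?_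
  have hz : κ z (Prod.mk z ⁻¹' s) = unif.map (quantile (κ z)) (Prod.mk z ⁻¹' s) := by
    rw [map_quantile_unif]
  rw [hz, Measure.map_apply (measurable_quantile _) (measurable_prodMk_left hs)]
  rfl

/-- If `(A, D)` is independent of `C` and `A` is independent of `D`, then `(A, C)` is independent
of `D`. -/
lemma indepFun_prodMk_of_indepFun {β γ : Type*} [MeasurableSpace β] [MeasurableSpace γ]
    {A : Ω → α} {D : Ω → β} {C : Ω → γ} (hA : Measurable A) (hD : Measurable D)
    (hC : Measurable C) (h1 : IndepFun (fun ω => (A ω, D ω)) C P) (h2 : IndepFun A D P) :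
    IndepFun (fun ω => (A ω, C ω)) D P := by
  have pA := Measure.isProbabilityMeasure_map (μ := P) hA.aemeasurable
  have pD := Measure.isProbabilityMeasure_map (μ := P) hD.aemeasurable
  have pC := Measure.isProbabilityMeasure_map (μ := P) hC.aemeasurable
  have h3 : IndepFun A C P := h1.comp measurable_fst measurable_id
  rw [indepFun_iff_map_prod_eq_prod_map_map (by fun_prop) (by fun_prop)]
  have := Measure.isProbabilityMeasure_map (μ := P)
    ((hA.prodMk hC).prodMk hD).aemeasurable
  refine Measure.ext_prod₃' fun {s t u} hs ht hu => ?_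
  rw [Measure.map_apply (by fun_prop) ((hs.prod ht).prod hu), Measure.prod_prod,
    Measure.map_apply (by fun_prop) (hs.prod ht), Measure.map_apply hD hu]
  have e1 : (fun ω => ((A ω, C ω), D ω)) ⁻¹' (s ×ˢ t) ×ˢ u =
      (fun ω => (A ω, D ω)) ⁻¹' (s ×ˢ u) ∩ C ⁻¹' t := by
    ext ω; simp only [Set.mem_preimage, Set.mem_prod, Set.mem_inter_iff]; tauto
  have e2 : (fun ω => (A ω, C ω)) ⁻¹' (s ×ˢ t) = A ⁻¹' s ∩ C ⁻¹' t := by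
    ext ω; simp
  have e3 : (fun ω => (A ω, D ω)) ⁻¹' (s ×ˢ u) = A ⁻¹' s ∩ D ⁻¹' u := by
    ext ω; simp
  rw [e1, h1.measure_inter_preimage_eq_mul _ _ (hs.prod hu) ht, e2, e3,
    h2.measure_inter_preimage_eq_mul _ _ hs hu, h3.measure_inter_preimage_eq_mul _ _ hs ht]
  ring

end Randomization

/-! ### The quantile transform -/

/-- The law of independent uniform variables on `[0, 1]`. -/
noncomputable abbrev unifPi (n : ℕ) : Measure (Path n) := Measure.pi fun _ : Fin n => unif

lemma map_eval_unifPi {n : ℕ} (t : Fin n) : (unifPi n).map (fun u => u t) = unif :=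
  (measurePreserving_eval (fun _ : Fin n => unif) t).map_eq

lemma unifPi_ae_mem_Ioo {n : ℕ} : ∀ᵐ u ∂(unifPi n), ∀ t, u t ∈ Set.Ioo (0 : ℝ) 1 := by
  rw [ae_all_iff]
  intro t
  have := unif_ae_mem_Ioo
  rw [← map_eval_unifPi t] at this
  exact ae_of_ae_map (measurable_pi_apply t).aemeasurable this

lemma iIndepFun_unifPi (n : ℕ) : iIndepFun (fun (t : Fin n) (u : Path n) => u t) (unifPi n) :=
  iIndepFun_pi (X := fun _ => id) fun _ => aemeasurable_id

lemma indepFun_of_iIndepFun_past {n : ℕ} {Ω : Type*} [MeasurableSpace Ω] {P : Measure Ω}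
    {d : Ω → Path n} (hd : Measurable d) (h : iIndepFun (fun t ω => d ω t) P) (t : Fin n) :
    IndepFun (fun ω => past t (d ω)) (fun ω => d ω t) P := by
  have h1 := h.indepFun_finset (Finset.Iio t) {t} (by simp) fun i => by fun_prop
  exact h1.comp (φ := fun (w : Finset.Iio t → ℝ) (s : Set.Iio t) => w ⟨s.1, Finset.mem_Iio.2 s.2⟩)
    (ψ := fun (w : ({t} : Finset (Fin n)) → ℝ) => w ⟨t, by simp⟩) (by fun_prop) (by fun_prop)

lemma indepFun_past_unifPi {n : ℕ} (t : Fin n) :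
    IndepFun (past t) (fun u : Path n => u t) (unifPi n) :=
  indepFun_of_iIndepFun_past measurable_id (iIndepFun_unifPi n) t

instance {n : ℕ} (μ : Measure (Path n)) [IsFiniteMeasure μ] (t : Fin n) :
    IsMarkovKernel (condLaw μ t) := by unfold condLaw; infer_instance

/-- A random path whose successive conditional laws are those of `μ` has law `μ`. -/
lemma map_eq_of_map_prodMk_past {n : ℕ} {μ : Measure (Path n)} [IsProbabilityMeasure μ]
    {Ω : Type*} [MeasurableSpace Ω] {P : Measure Ω} [IsProbabilityMeasure P] {X : Ω → Path n}
    (hX : Measurable X)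
    (h : ∀ t, P.map (fun ω => (past t (X ω), X ω t)) =
      P.map (fun ω => past t (X ω)) ⊗ₘ condLaw μ t) : P.map X = μ := by
  -- Coordinates from `k` on are set to 0, so the induction on `k` compares laws on one fixed space.
  set trunc : ℕ → Path n → Path n := fun k x s => if s.1 < k then x s else 0 with htrunc
  have hmt : ∀ k, Measurable (trunc k) := by
    intro k
    refine measurable_pi_iff.2 fun s => ?_
    by_cases hs : s.1 < k
    · simp only [htrunc, hs, if_true]; fun_prop
    · simp only [htrunc, hs, if_false]; fun_prop
  have key : ∀ k ≤ n, P.map (fun ω => trunc k (X ω)) = μ.map (trunc k) := by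
    intro k
    induction k with
    | zero =>
      intro _
      have h0 : trunc 0 = fun _ => 0 := by funext x s; simp [htrunc]
      simp [h0, Measure.map_const]
    | succ k ih =>
      intro hk
      have ih := ih (by omega)
      set t : Fin n := ⟨k, by omega⟩ with ht
      have hp : ∀ x, past t (trunc k x) = past t x := fun x =>
        past_congr fun s hs => by
          have : s.1 < k := hs
          simp [htrunc, this]
      set glue : (Set.Iio t → ℝ) × ℝ → Path n := fun p s =>
        if s = t then p.2 else extend t p.1 s with hglue
      have hmg : Measurable glue := by
        refine measurable_pi_iff.2 fun s => ?_
        by_cases hs : s = t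
        · simp only [hglue, hs, if_true]; fun_prop
        · simp only [hglue, hs, if_false]; fun_prop
      have hg : ∀ x, trunc (k + 1) x = glue (past t x, x t) := by
        intro x; funext s
        by_cases hs : s = t
        · subst hs; simp [hglue, htrunc, ht]
        · have hs' : s.1 ≠ k := fun h => hs (Fin.ext h)
          by_cases hlt : s.1 < k
          · have hst : s < t := hlt
            simp only [hglue, hs, if_false, extend_past_apply hst, htrunc]
            rw [if_pos (by omega)]
          · have hst : ¬ s < t := hlt
            simp only [hglue, hs, if_false, extend, hst, dite_false, htrunc]
            rw [if_neg (by omega)]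
      have hpast : P.map (fun ω => past t (X ω)) = μ.map (past t) := by
        have := congrArg (Measure.map (past t)) ih
        rw [Measure.map_map (g := past t) (f := fun ω => trunc k (X ω)) (by fun_prop)
          ((hmt k).comp hX), Measure.map_map (by fun_prop) (hmt k)] at this
        simpa only [Function.comp_def, hp] using this
      have hpair : P.map (fun ω => (past t (X ω), X ω t)) = μ.map (fun x => (past t x, x t)) := by
        rw [h t, hpast]
        exact compProd_map_condDistrib (measurable_pi_apply t).aemeasurable
      have := congrArg (Measure.map glue) hpair
      rw [Measure.map_map hmg (by fun_prop), Measure.map_map hmg (by fun_prop)] at this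
      simp only [Function.comp_def, ← hg] at this
      exact this
  have hn : trunc n = id := by funext x s; simp [htrunc]
  have := key n le_rfl
  rw [hn] at this
  simpa using this

section QuantileTransform

variable {n : ℕ} (μ : Measure (Path n)) [IsProbabilityMeasure μ]

lemma quantileTransform_apply (u : Path n) (t : Fin n) :
    quantileTransform μ u t = quantile (condLaw μ t (past t (quantileTransform μ u))) (u t) := by
  rw [quantileTransform]
  rfl

lemma quantileTransform_congr {u v : Path n} {t : Fin n} (h : ∀ s ≤ t, u s = v s) :
    quantileTransform μ u t = quantileTransform μ v t := by
  induction t using WellFoundedLT.induction with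
  | _ t ih =>
    rw [quantileTransform_apply, quantileTransform_apply, h t le_rfl,
      past_congr fun s hs => ih s hs fun r hr => h r (hr.trans hs.le)]

@[fun_prop]
lemma measurable_quantileTransform : Measurable (quantileTransform μ) := by
  refine measurable_pi_iff.2 fun t => ?_
  induction t using WellFoundedLT.induction with
  | _ t ih =>
    simp_rw [quantileTransform_apply μ _ t]
    refine (measurable_quantile_kernel (condLaw μ t)).comp (Measurable.prodMk ?_ (by fun_prop))
    exact measurable_pi_iff.2 fun s => ih s.1 s.2

/-- The transform is adapted to `u`; writing its past as a function of the past of `u` yields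
independence from `u t`. -/
lemma past_quantileTransform (u : Path n) (t : Fin n) :
    past t (quantileTransform μ u) = past t (quantileTransform μ (extend t (past t u))) :=
  past_congr fun _ hs => quantileTransform_congr μ fun _ hr =>
    (extend_past_apply (hr.trans_lt hs) u).symm

lemma indepFun_past_quantileTransform (t : Fin n) :
    IndepFun (fun u => past t (quantileTransform μ u)) (fun u : Path n => u t) (unifPi n) := by
  rw [funext fun u => past_quantileTransform μ u t]
  exact (indepFun_past_unifPi t).comp
    (φ := fun w => past t (quantileTransform μ (extend t w))) (by fun_prop) measurable_id

/-- The quantile transform of `μ`, driven by independent uniform variables, has law `μ`. -/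
lemma map_quantileTransform : (unifPi n).map (quantileTransform μ) = μ := by
  refine map_eq_of_map_prodMk_past (by fun_prop) fun t => ?_
  simp_rw [quantileTransform_apply μ _ t]
  exact map_prodMk_quantile (by fun_prop) (by fun_prop) (indepFun_past_quantileTransform μ t)
    (map_eval_unifPi t) (condLaw μ t)

lemma map_past_quantileTransform (t : Fin n) :
    (unifPi n).map (fun u => past t (quantileTransform μ u)) = μ.map (past t) := by
  conv_rhs => rw [← map_quantileTransform μ, Measure.map_map (by fun_prop) (by fun_prop)]
  rfl

end QuantileTransform

/-! ### Independent increments -/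

section IndependentIncrements

variable {N : ℕ} {μ : Measure (Path (N + 1))} [IsProbabilityMeasure μ]

lemma past_cumsum {t : Fin (N + 1)} (d : Path (N + 1)) :
    past t (cumsum d) = past t (cumsum (extend t (past t d))) :=
  past_congr fun _ hs => cumsum_congr fun _ hr => (extend_past_apply (hr.trans_lt hs) d).symm

omit [IsProbabilityMeasure μ] in
lemma HasIndependentIncrements.indepFun_past (hμ : HasIndependentIncrements μ) (t : Fin (N + 1)) :
    IndepFun (past t) (fun x => incr x t) μ := by
  have h := indepFun_of_iIndepFun_past measurable_incr hμ t
  have h2 := h.comp (φ := fun w => past t (cumsum (extend t w))) (ψ := id) (by fun_prop)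
    measurable_id
  have : (fun w => past t (cumsum (extend t w))) ∘ (fun x : Path (N + 1) => past t (incr x)) =
      past t := by
    funext x
    simp only [Function.comp_apply]
    rw [← past_cumsum, cumsum_incr]
  rw [this] at h2
  exact h2

/-- As `x_t` is the previous value plus an increment independent of the past, the translated
increment law disintegrates the law of the past and `x_t`; disintegrations are almost surely unique.
-/
lemma HasIndependentIncrements.condLaw_ae_eq (hμ : HasIndependentIncrements μ)
    (t : Fin (N + 1)) : ∀ᵐ w ∂(μ.map (past t)),
      condLaw μ t w = (μ.map fun x => incr x t).map (· + prev t w) := by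
  set ρ := μ.map fun x => incr x t with hρ
  have hρp : IsProbabilityMeasure ρ := Measure.isProbabilityMeasure_map (by fun_prop)
  set κ : Kernel (Set.Iio t → ℝ) ℝ :=
    (Kernel.deterministic (prev t) (measurable_prev t) ×ₖ Kernel.const _ ρ).map
      (fun p : ℝ × ℝ => p.2 + p.1) with hκ
  have hm : Measurable (fun p : ℝ × ℝ => p.2 + p.1) := by fun_prop
  have : IsMarkovKernel κ := Kernel.IsMarkovKernel.map _ hm
  have hκw : ∀ w, κ w = ρ.map (· + prev t w) := by
    intro w
    rw [hκ, Kernel.map_apply _ hm, Kernel.prod_apply, Kernel.deterministic_apply,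
      Kernel.const_apply, Measure.dirac_prod, Measure.map_map hm (by fun_prop)]
    rfl
  have hprod := (indepFun_iff_map_prod_eq_prod_map_map (by fun_prop) (by fun_prop)).1
    (hμ.indepFun_past t)
  have hmain : μ.map (fun x => (past t x, x t)) = μ.map (past t) ⊗ₘ κ := by
    have hm2 : Measurable fun p : (Set.Iio t → ℝ) × ℝ => (p.1, p.2 + prev t p.1) := by fun_prop
    have e : μ.map (fun x => (past t x, x t)) =
        ((μ.map (past t)).prod ρ).map fun p => (p.1, p.2 + prev t p.1) := by
      rw [← hprod, Measure.map_map hm2 (by fun_prop)]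
      congr 1
      funext x
      simp [incr_eq_sub_prev]
    rw [e]
    ext s hs
    rw [Measure.map_apply hm2 hs, Measure.prod_apply (hm2 hs), Measure.compProd_apply hs]
    refine lintegral_congr fun w => ?_
    rw [hκw, Measure.map_apply (by fun_prop) (measurable_prodMk_left hs)]
    rfl
  filter_upwards [condDistrib_ae_eq_of_measure_eq_compProd (past t)
    (measurable_pi_apply t).aemeasurable hmain] with w hw
  rw [← hκw, ← hw]
  rfl

lemma HasIndependentIncrements.condLaw_quantileTransform_ae_eq (hμ : HasIndependentIncrements μ) :
    ∀ᵐ u ∂(unifPi (N + 1)), ∀ t, condLaw μ t (past t (quantileTransform μ u)) =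
      (μ.map fun x => incr x t).map (· + prev t (past t (quantileTransform μ u))) := by
  rw [ae_all_iff]
  intro t
  have := hμ.condLaw_ae_eq t
  rw [← map_past_quantileTransform μ t] at this
  exact ae_of_ae_map (by fun_prop) this

/-- With independent increments, the increments of the quantile transform are the quantiles of the
laws of the increments. -/
lemma HasIndependentIncrements.quantileTransform_ae_eq (hμ : HasIndependentIncrements μ) :
    ∀ᵐ u ∂(unifPi (N + 1)), quantileTransform μ u =
      cumsum fun t => quantile (μ.map fun x => incr x t) (u t) := by
  filter_upwards [unifPi_ae_mem_Ioo, hμ.condLaw_quantileTransform_ae_eq] with u hu1 hu2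
  refine eq_cumsum_of_incr_eq (funext fun t => ?_)
  have : IsProbabilityMeasure (μ.map fun x => incr x t) :=
    Measure.isProbabilityMeasure_map (by fun_prop)
  rw [incr_eq_sub_prev, quantileTransform_apply, hu2 t, quantile_map_add _ _ (hu1 t)]
  ring

end IndependentIncrements

/-! ### Criteria for causality -/

/-- Padding with zeros after time `t` factors `f` through the restriction to times up to `t`. -/
lemma measurable_piLE_of_congr {n : ℕ} {β : Type*} [MeasurableSpace β] {t : Fin n}
    {f : Path n → β} (hf : Measurable f) (h : ∀ x y, (∀ s ≤ t, x s = y s) → f x = f y) :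
    Measurable[Filtration.piLE (X := fun _ : Fin n => ℝ) t] f := by
  set e : (Set.Iic t → ℝ) → Path n := fun w s => if h : s ≤ t then w ⟨s, h⟩ else 0 with he
  have hem : Measurable e := by
    refine measurable_pi_iff.2 fun s => ?_
    by_cases hs : s ≤ t
    · simp only [he, hs, dite_true]; fun_prop
    · simp only [he, hs, dite_false]; fun_prop
  have : f = (f ∘ e) ∘ Preorder.restrictLe t := by
    funext x
    refine h _ _ fun s hs => ?_
    simp [he, hs, Preorder.restrictLe]
  rw [this]
  exact (hf.comp hem).comp (comap_measurable _)

/-- A plan that is obtained from `μ` by adding independent randomness to an adapted map is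
causal. -/
lemma map_mem_causalPlans_of_adapted {n : ℕ} {μ ν : Measure (Path n)} [IsProbabilityMeasure μ]
    {α : Type*} [MeasurableSpace α] (ρ : Measure α) [IsProbabilityMeasure ρ]
    {Ψ : Path n × α → Path n} (hΨ : Measurable Ψ)
    (hadapt : ∀ t x x' v, (∀ s ≤ t, x s = x' s) → ∀ s ≤ t, Ψ (x, v) s = Ψ (x', v) s)
    (hν : (μ.prod ρ).map Ψ = ν) :
    (μ.prod ρ).map (fun p => (p.1, Ψ p)) ∈ causalPlans μ ν := by
  have hm : Measurable fun p : Path n × α => (p.1, Ψ p) := measurable_fst.prodMk hΨ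
  refine ⟨⟨?_, ?_⟩, (Kernel.id ×ₖ Kernel.const _ ρ).map Ψ, Kernel.IsMarkovKernel.map _ hΨ, ?_, ?_⟩
  · rw [Measure.map_map measurable_fst hm]
    exact Measure.fst_prod
  · rw [Measure.map_map measurable_snd hm]
    exact hν
  all_goals
    have hκ : ∀ (x : Path n) (B : Set (Path n)), MeasurableSet B →
        ((Kernel.id ×ₖ Kernel.const (Path n) ρ).map Ψ) x B = ρ {v | Ψ (x, v) ∈ B} := by
      intro x B hB
      rw [Kernel.map_apply' _ hΨ _ hB, Kernel.prod_apply, Kernel.id_apply, Kernel.const_apply,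
        Measure.dirac_prod, Measure.map_apply measurable_prodMk_left (hΨ hB)]
      rfl
  · have := Kernel.IsMarkovKernel.map (Kernel.id ×ₖ Kernel.const (Path n) ρ) hΨ
    ext s hs
    rw [Measure.compProd_apply hs, Measure.map_apply hm hs, Measure.prod_apply (hm hs)]
    refine lintegral_congr fun x => ?_
    rw [hκ _ _ (measurable_prodMk_left hs)]
    rfl
  · intro t B hB
    have hB' : MeasurableSet B := (Filtration.piLE (X := fun _ : Fin n => ℝ)).le t _ hB
    refine ⟨_, measurable_piLE_of_congr (Kernel.measurable_coe _ hB') ?_, Filter.EventuallyEq.rfl⟩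
    intro x y hxy
    rw [hκ _ _ hB', hκ _ _ hB']
    obtain ⟨C, -, rfl⟩ := hB
    congr 1
    ext v
    have : Preorder.restrictLe t (Ψ (x, v)) = Preorder.restrictLe t (Ψ (y, v)) :=
      funext fun s => hadapt t x y v hxy s.1 s.2
    simp only [Set.mem_ofPred_eq, Set.mem_preimage, this]

section Causal

variable {N : ℕ} {μ ν : Measure (Path (N + 1))} [IsProbabilityMeasure μ]

lemma isProbabilityMeasure_of_mem_plans {n : ℕ} {μ ν : Measure (Path n)} [IsProbabilityMeasure μ]
    {γ : Measure (Path n × Path n)} (h : γ ∈ plans μ ν) : IsProbabilityMeasure γ := by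
  constructor
  rw [← measure_univ (μ := μ), ← h.1, Measure.map_apply measurable_fst .univ, Set.preimage_univ]

/-- Under a causal plan, the increments of `x` are independent of the past of `y`. -/
lemma HasIndependentIncrements.indepFun_of_mem_causalPlans (hμ : HasIndependentIncrements μ)
    {γ : Measure (Path (N + 1) × Path (N + 1))} (hγ : γ ∈ causalPlans μ ν) (t : Fin (N + 1)) :
    IndepFun (fun p => past t p.2) (fun p => incr p.1 t) γ := by
  obtain ⟨hplan, κ, hκ, rfl, hcausal⟩ := hγ
  rw [indepFun_iff_measure_inter_preimage_eq_mul]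
  intro B A hB hA
  -- Causality is applied one step before `t`, so that `f` depends on `x` strictly before `t`. At
  -- the initial time the past is a single point and the event is empty or everything.
  obtain ⟨f, hf, hκf⟩ : ∃ f : Path (N + 1) → ℝ≥0∞, Measurable[MeasurableSpace.comap (past t)
      inferInstance] f ∧ (fun x => κ x (past t ⁻¹' B)) =ᵐ[μ] f := by
    rcases Fin.eq_zero_or_eq_succ t with rfl | ⟨s, rfl⟩
    · have : past (0 : Fin (N + 1)) ⁻¹' B = ∅ ∨ past (0 : Fin (N + 1)) ⁻¹' B = Set.univ := by
        have hss : ∀ x y : Path (N + 1), past 0 x = past 0 y := fun x y =>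
          past_congr fun s hs => absurd hs (Fin.not_lt_zero s)
        by_cases h : ∃ x : Path (N + 1), past 0 x ∈ B
        · obtain ⟨x, hx⟩ := h
          right; ext y; simp only [Set.mem_preimage, Set.mem_univ, iff_true]
          rwa [hss y x]
        · left; ext y; simp only [Set.mem_preimage, Set.mem_empty_iff_false, iff_false]
          exact fun hy => h ⟨y, hy⟩
      rcases this with h | h
      · exact ⟨0, measurable_const, by simp [h]; rfl⟩
      · exact ⟨1, measurable_const, by simp [h]; rfl⟩
    · have hcs : ∀ r : Fin (N + 1), r < s.succ ↔ r ≤ s.castSucc := fun r => by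
        simp only [Fin.lt_def, Fin.le_def, Fin.val_succ, Fin.val_castSucc]; omega
      have hle : MeasurableSet[Filtration.piLE (X := fun _ : Fin (N + 1) => ℝ) s.castSucc]
          (past s.succ ⁻¹' B) := by
        refine ⟨(fun w (r : Set.Iio s.succ) => w ⟨r.1, (hcs r.1).1 r.2⟩) ⁻¹' B, ?_, rfl⟩
        have : Measurable fun (w : Set.Iic s.castSucc → ℝ) (r : Set.Iio s.succ) =>
          w ⟨r.1, (hcs r.1).1 r.2⟩ := by fun_prop
        exact this hB
      obtain ⟨f, hf, hκf⟩ := hcausal _ _ hle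
      refine ⟨f, hf.mono ?_ le_rfl, hκf⟩
      have : Preorder.restrictLe (π := fun _ => ℝ) s.castSucc =
        (fun w (r : Set.Iic s.castSucc) => w ⟨r.1, (hcs r.1).2 r.2⟩) ∘ past s.succ := rfl
      simp only [Filtration.piLE]
      rw [this, ← MeasurableSpace.comap_comp]
      refine MeasurableSpace.comap_mono (Measurable.comap_le ?_)
      fun_prop
  have hle : MeasurableSpace.comap (past t) inferInstance ≤
    (inferInstance : MeasurableSpace (Path (N + 1))) := (measurable_past t).comap_le
  have hA' : MeasurableSet {x : Path (N + 1) | incr x t ∈ A} := measurable_incr_apply t hA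
  have hB' : MeasurableSet (past t ⁻¹' B) := measurable_past t hB
  have e1 : (fun p : Path (N + 1) × Path (N + 1) => past t p.2) ⁻¹' B ∩
      (fun p => incr p.1 t) ⁻¹' A = {x : Path (N + 1) | incr x t ∈ A} ×ˢ (past t ⁻¹' B) := by
    ext p; simp only [Set.mem_inter_iff, Set.mem_preimage, Set.mem_prod, Set.mem_ofPred_eq]; tauto
  have e2 : (fun p : Path (N + 1) × Path (N + 1) => past t p.2) ⁻¹' B =
      Set.univ ×ˢ (past t ⁻¹' B) := by ext p; simp
  have e3 : (fun p : Path (N + 1) × Path (N + 1) => incr p.1 t) ⁻¹' A =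
      {x : Path (N + 1) | incr x t ∈ A} ×ˢ Set.univ := by ext p; simp
  rw [e1, e2, e3, Measure.compProd_apply_prod hA' hB', Measure.compProd_apply_prod .univ hB',
    Measure.compProd_apply_prod hA' .univ]
  simp only [measure_univ, setLIntegral_const, one_mul, setLIntegral_univ]
  rw [lintegral_congr_ae hκf, lintegral_congr_ae (ae_restrict_of_ae hκf)]
  -- The joint probability is the integral of `f` over `{incr x t ∈ A}`; it factors since `f`
  -- depends on the past of `x`, which is independent of the increment.
  have hind := (IndepFun_iff_Indep _ _ _).1 (hμ.indepFun_past t)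
  have := lintegral_mul_eq_lintegral_mul_lintegral_of_independent_measurableSpace
    (f := f) (g := {x : Path (N + 1) | incr x t ∈ A}.indicator 1) hle
    (measurable_incr_apply t).comap_le hind hf
    ((measurable_one.indicator hA : Measurable (A.indicator (1 : ℝ → ℝ≥0∞))).comp
      (comap_measurable _))
  rw [lintegral_indicator_one hA'] at this
  rw [← this, ← lintegral_indicator hA']
  refine lintegral_congr fun x => ?_
  by_cases hx : incr x t ∈ A <;> simp [hx]

/-- Iterated use of the independence of `d t` from the past. -/
lemma measure_inter_iInter_preimage_eq_mul {n : ℕ} {Ω : Type*} {α : Fin n → Type*}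
    [MeasurableSpace Ω] [∀ t, MeasurableSpace (α t)] {P : Measure Ω} {d : Ω → Path n}
    {Z : ∀ t, Ω → α t}
    (hind : ∀ t, IndepFun (fun ω => (past t (d ω), Z t ω)) (fun ω => d ω t) P)
    {A : Fin n → Set ℝ} (hA : ∀ t, MeasurableSet (A t)) (S : Finset (Fin n)) (W : Set Ω)
    (hW : ∀ t ∈ S, MeasurableSet[MeasurableSpace.comap (fun ω => (past t (d ω), Z t ω))
      inferInstance] W) :
    P (W ∩ ⋂ t ∈ S, {ω | d ω t ∈ A t}) = P W * ∏ t ∈ S, P {ω | d ω t ∈ A t} := by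
  -- The latest time `a` is peeled off: `W` and all constraints at earlier times belong to the
  -- σ-algebra that is independent of `d a`.
  induction S using Finset.induction_on_max with
  | empty => simp
  | insert a S hlt ih =>
    have ha : a ∉ S := fun h => (hlt a h).false
    have ih := ih fun t ht => hW t (Finset.mem_insert_of_mem ht)
    have e : W ∩ ⋂ t ∈ insert a S, {ω | d ω t ∈ A t} =
        (W ∩ ⋂ t ∈ S, {ω | d ω t ∈ A t}) ∩ {ω | d ω a ∈ A a} := by
      rw [Finset.set_biInter_insert]
      ext ω; simp only [Set.mem_inter_iff]; tauto
    rw [e, Finset.prod_insert ha, mul_left_comm, ← ih, mul_comm]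
    have hm : MeasurableSet[MeasurableSpace.comap (fun ω => (past a (d ω), Z a ω)) inferInstance]
        (W ∩ ⋂ t ∈ S, {ω | d ω t ∈ A t}) := by
      refine (hW a (Finset.mem_insert_self _ _)).inter (Finset.measurableSet_biInter _ ?_)
      intro t ht
      refine ⟨(fun p : (Set.Iio a → ℝ) × α a => p.1 ⟨t, hlt t ht⟩) ⁻¹' A t, ?_, rfl⟩
      have : Measurable fun p : (Set.Iio a → ℝ) × α a => p.1 ⟨t, hlt t ht⟩ := by fun_prop
      exact this (hA t)
    exact (Indep_iff _ _ _).1 ((IndepFun_iff_Indep _ _ _).1 (hind a)) _ _ hm ⟨A a, hA a, rfl⟩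

/-- If the increments of `x` have the same laws as under `μ` and each is independent of the past of
`x` and `y`, then the joint law of `x` and `y` is causal. -/
lemma HasIndependentIncrements.map_mem_causalPlans (hμ : HasIndependentIncrements μ)
    {Ω : Type*} [MeasurableSpace Ω] {P : Measure Ω} [IsProbabilityMeasure P]
    {d Y : Ω → Path (N + 1)} (hd : Measurable d) (hY : Measurable Y)
    (hlaw : ∀ t, P.map (fun ω => d ω t) = μ.map fun x => incr x t)
    (hind : ∀ t, IndepFun (fun ω => (past t (d ω), past t (Y ω))) (fun ω => d ω t) P)
    (hν : P.map Y = ν) :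
    P.map (fun ω => (cumsum (d ω), Y ω)) ∈ causalPlans μ ν := by
  set X : Ω → Path (N + 1) := fun ω => cumsum (d ω) with hXdef
  have hX : Measurable X := by fun_prop
  have hρ : ∀ (t : Fin (N + 1)) {A : Set ℝ}, MeasurableSet A →
      P {ω | d ω t ∈ A} = μ {x | incr x t ∈ A} := by
    intro t A hA
    have h := congrArg (fun m => m A) (hlaw t)
    simp only [Measure.map_apply (show Measurable fun ω => d ω t by fun_prop) hA,
      Measure.map_apply (measurable_incr_apply t) hA] at h
    exact h
  have hdpi : P.map d = μ.map incr := by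
    have h2 := iIndepFun.map_fun_eq_pi_map (fun t => (measurable_incr_apply t).aemeasurable) hμ
    refine Eq.trans ?_ h2.symm
    have hp : ∀ t, IsProbabilityMeasure (μ.map fun x : Path (N + 1) => incr x t) := fun t =>
      Measure.isProbabilityMeasure_map (by fun_prop)
    refine (Measure.pi_eq fun s hs => ?_).symm
    rw [Measure.map_apply hd (.univ_pi hs)]
    have h3 := measure_inter_iInter_preimage_eq_mul hind hs Finset.univ Set.univ
      fun _ _ => MeasurableSet.univ
    rw [measure_univ, one_mul, Set.univ_inter] at h3
    have e : d ⁻¹' Set.univ.pi s = ⋂ t ∈ Finset.univ, {ω | d ω t ∈ s t} := by ext ω; simp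
    rw [e, h3]
    refine Finset.prod_congr rfl fun t _ => ?_
    rw [hρ t (hs t), Measure.map_apply (measurable_incr_apply t) (hs t)]
    rfl
  have hXμ : P.map X = μ := by
    have := congrArg (Measure.map cumsum) hdpi
    rw [Measure.map_map measurable_cumsum hd, Measure.map_map measurable_cumsum measurable_incr]
      at this
    have e : (cumsum ∘ incr : Path (N + 1) → Path (N + 1)) = id := funext cumsum_incr
    rw [e, Measure.map_id] at this
    exact this
  refine ⟨⟨?_, ?_⟩, condDistrib Y X P, inferInstance, ?_, fun t B hB => ?_⟩
  · rw [Measure.map_map measurable_fst (by fun_prop)]; exact hXμ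
  · rw [Measure.map_map measurable_snd (by fun_prop)]; exact hν
  · rw [← hXμ]; exact compProd_map_condDistrib hY.aemeasurable
  have hB' : MeasurableSet B := (Filtration.piLE (X := fun _ : Fin (N + 1) => ℝ)).le t _ hB
  set R : Path (N + 1) → (Set.Iic t → ℝ) := Preorder.restrictLe t with hR
  have hRm : Measurable R := Preorder.measurable_restrictLe t
  -- The adapted version is the conditional probability of `Y ∈ B` given `X` only up to time `t`.
  set f : Path (N + 1) → ℝ≥0∞ := fun x => condDistrib Y (fun ω => R (X ω)) P (R x) B with hf
  have hfR : Measurable[Filtration.piLE (X := fun _ : Fin (N + 1) => ℝ) t] f :=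
    (Kernel.measurable_coe _ hB').comp (comap_measurable _)
  have hfm : Measurable f := (Kernel.measurable_coe _ hB').comp hRm
  have hκm : Measurable fun x => condDistrib Y X P x B := Kernel.measurable_coe _ hB'
  refine ⟨f, hfR, ?_⟩
  -- Both versions are compared as densities on boxes in increment coordinates. These suffice: boxes
  -- form a generating π-system and `cumsum` inverts `incr`.
  have key : ∀ A : Fin (N + 1) → Set ℝ, (∀ s, MeasurableSet (A s)) →
      (μ.withDensity fun x => condDistrib Y X P x B) (incr ⁻¹' Set.univ.pi A) =
      (μ.withDensity f) (incr ⁻¹' Set.univ.pi A) := by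
    intro A hA
    have hpre : MeasurableSet (incr ⁻¹' Set.univ.pi A : Set (Path (N + 1))) :=
      measurable_incr (.univ_pi hA)
    set W : Set (Path (N + 1)) := ⋂ s ∈ Finset.Iic t, {x | incr x s ∈ A s} with hW
    set D : Set (Path (N + 1)) := ⋂ s ∈ Finset.Ioi t, {x | incr x s ∈ A s} with hD
    have hsplit : incr ⁻¹' Set.univ.pi A = W ∩ D := by
      ext x
      simp only [Set.mem_preimage, Set.mem_univ_pi, hW, hD, Set.mem_inter_iff, Set.mem_iInter,
        Finset.mem_Iic, Finset.mem_Ioi, Set.mem_ofPred_eq]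
      exact ⟨fun h => ⟨fun s _ => h s, fun s _ => h s⟩, fun h s =>
        (le_or_gt s t).elim (h.1 s) (h.2 s)⟩
    have hWt : MeasurableSet[Filtration.piLE (X := fun _ : Fin (N + 1) => ℝ) t] W := by
      refine Finset.measurableSet_biInter _ fun s hs => ?_
      exact measurable_piLE_of_congr (measurable_incr_apply s)
        (fun x y h => incr_congr fun r hr => h r (hr.trans (Finset.mem_Iic.1 hs))) (hA s)
    have hWm : MeasurableSet W := (Filtration.piLE (X := fun _ : Fin (N + 1) => ℝ)).le t _ hWt
    have hDm : MeasurableSet D :=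
      Finset.measurableSet_biInter _ fun s _ => measurable_incr_apply s (hA s)
    have hDμ : μ D = ∏ s ∈ Finset.Ioi t, μ {x | incr x s ∈ A s} :=
      iIndepFun_iff_measure_inter_preimage_eq_mul.1 hμ _ fun s _ => hA s
    rw [withDensity_apply _ hpre, withDensity_apply _ hpre]
    -- `W` constrains increments up to `t` and `D` the later ones. On the left, later increments
    -- split off because `hind` makes each independent of the past of both processes; on the right,
    -- because `f` and `W` involve only times up to `t`.
    trans P (X ⁻¹' W ∩ Y ⁻¹' B) * μ D
    · conv_lhs => rw [← hXμ]
      rw [setLIntegral_map hpre hκm hX, setLIntegral_preimage_condDistrib hX hY.aemeasurable hB'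
        hpre]
      have h := measure_inter_iInter_preimage_eq_mul hind hA (Finset.Ioi t) (X ⁻¹' W ∩ Y ⁻¹' B) ?_
      · have e : X ⁻¹' (incr ⁻¹' Set.univ.pi A) ∩ Y ⁻¹' B =
            (X ⁻¹' W ∩ Y ⁻¹' B) ∩ ⋂ s ∈ Finset.Ioi t, {ω | d ω s ∈ A s} := by
          rw [hsplit]
          have : X ⁻¹' D = ⋂ s ∈ Finset.Ioi t, {ω | d ω s ∈ A s} := by
            ext ω; simp [hD, hXdef, incr_cumsum]
          rw [Set.preimage_inter, this]
          ext ω; simp only [Set.mem_inter_iff]; tauto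
        rw [e, h, hDμ]
        congr 1
        exact Finset.prod_congr rfl fun s _ => hρ s (hA s)
      · intro a ha
        have hta : t < a := Finset.mem_Ioi.1 ha
        refine MeasurableSet.inter ?_ ?_
        · have : X ⁻¹' W = ⋂ s ∈ Finset.Iic t, {ω | d ω s ∈ A s} := by
            ext ω; simp [hW, hXdef, incr_cumsum]
          rw [this]
          refine Finset.measurableSet_biInter _ fun s hs => ?_
          have hsa : s < a := (Finset.mem_Iic.1 hs).trans_lt hta
          refine ⟨(fun p : (Set.Iio a → ℝ) × (Set.Iio a → ℝ) => p.1 ⟨s, hsa⟩) ⁻¹' A s, ?_, rfl⟩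
          have : Measurable fun p : (Set.Iio a → ℝ) × (Set.Iio a → ℝ) => p.1 ⟨s, hsa⟩ := by
            fun_prop
          exact this (hA s)
        · obtain ⟨C, hC, rfl⟩ := hB
          have : Measurable fun (p : (Set.Iio a → ℝ) × (Set.Iio a → ℝ)) (s : Set.Iic t) =>
            p.2 ⟨s.1, lt_of_le_of_lt s.2 hta⟩ := by fun_prop
          exact ⟨_, this hC, rfl⟩
    · set g : Path (N + 1) → ℝ≥0∞ := W.indicator f with hg
      have hgm : Measurable g := hfm.indicator hWm
      set ext : (Finset.Iic t → ℝ) → Path (N + 1) := fun w s =>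
        if h : s ≤ t then w ⟨s, Finset.mem_Iic.2 h⟩ else 0 with hext
      have hextm : Measurable ext := by
        refine measurable_pi_iff.2 fun s => ?_
        by_cases hs : s ≤ t
        · simp only [hext, hs, dite_true]; fun_prop
        · simp only [hext, hs, dite_false]; fun_prop
      have hgcongr : ∀ x y, (∀ s ≤ t, x s = y s) → g x = g y := by
        intro x y h
        have hRxy : R x = R y := funext fun s => h s.1 s.2
        have hWxy : x ∈ W ↔ y ∈ W := by
          obtain ⟨C, -, hC⟩ := hWt
          rw [← hC]
          change R x ∈ C ↔ R y ∈ C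
          rw [hRxy]
        by_cases hx : x ∈ W
        · rw [hg, Set.indicator_of_mem hx, Set.indicator_of_mem (hWxy.1 hx), hf]
          simp only [hRxy]
        · rw [hg, Set.indicator_of_notMem hx, Set.indicator_of_notMem (fun h => hx (hWxy.2 h))]
      have hind2 := iIndepFun.indepFun_finset (Finset.Iic t) (Finset.Ioi t)
        (Finset.disjoint_left.2 fun s h1 h2 =>
          absurd (Finset.mem_Iic.1 h1) (not_le.2 (Finset.mem_Ioi.1 h2))) hμ
        fun s => measurable_incr_apply s
      have hDfm : MeasurableSet {w : Finset.Ioi t → ℝ | ∀ s, w s ∈ A s.1} := by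
        rw [Set.ofPred_forall]
        exact MeasurableSet.iInter fun s => measurable_pi_apply s (hA s.1)
      have hind3 := hind2.comp (φ := fun w => g (cumsum (ext w)))
        (ψ := {w : Finset.Ioi t → ℝ | ∀ s, w s ∈ A s.1}.indicator (1 : (Finset.Ioi t → ℝ) → ℝ≥0∞))
        (hgm.comp (measurable_cumsum.comp hextm)) (measurable_one.indicator hDfm)
      have e1 : (fun w => g (cumsum (ext w))) ∘
          (fun (x : Path (N + 1)) (s : Finset.Iic t) => incr x s) = g := by
        funext x
        refine hgcongr _ _ fun s hs => ?_
        conv_rhs => rw [← cumsum_incr x]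
        exact cumsum_congr fun r hr => by simp [hext, hr.trans hs]
      have e2 : ({w : Finset.Ioi t → ℝ | ∀ s, w s ∈ A s.1}.indicator (1 : (Finset.Ioi t → ℝ) → ℝ≥0∞)) ∘
          (fun (x : Path (N + 1)) (s : Finset.Ioi t) => incr x s) = D.indicator 1 := by
        funext x
        have hiff : (fun s : Finset.Ioi t => incr x s) ∈
            {w : Finset.Ioi t → ℝ | ∀ s, w s ∈ A s.1} ↔ x ∈ D := by
          simp [hD]
        rw [Function.comp_apply]
        by_cases hx : x ∈ D
        · rw [Set.indicator_of_mem hx, Set.indicator_of_mem (hiff.2 hx)]; rfl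
        · rw [Set.indicator_of_notMem hx, Set.indicator_of_notMem fun h => hx (hiff.1 h)]
      rw [e1, e2] at hind3
      have hmul := lintegral_mul_eq_lintegral_mul_lintegral_of_indepFun hgm
        (measurable_one.indicator hDm) hind3
      have e3 : ∫⁻ x in incr ⁻¹' Set.univ.pi A, f x ∂μ =
          ∫⁻ x, (g * D.indicator (1 : Path (N + 1) → ℝ≥0∞)) x ∂μ := by
        rw [← lintegral_indicator hpre, hsplit]
        refine lintegral_congr fun x => ?_
        by_cases h1 : x ∈ W <;> by_cases h2 : x ∈ D <;> simp [hg, h1, h2]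
      rw [e3, hmul, lintegral_indicator_one hDm, hg, lintegral_indicator hWm]
      congr 1
      conv_rhs => rw [← hXμ]
      obtain ⟨C, hC, hCW⟩ := hWt
      rw [setLIntegral_map hWm hfm hX, ← hCW]
      exact (setLIntegral_preimage_condDistrib (X := fun ω => R (X ω)) (hRm.comp hX)
        hY.aemeasurable hB' hC).symm
  have hfin : ∫⁻ x, condDistrib Y X P x B ∂μ ≠ ⊤ := by
    refine ((lintegral_mono fun x => prob_le_one).trans_lt (b := ∫⁻ _, 1 ∂μ) ?_).ne
    simp
  refine (withDensity_eq_iff hκm.aemeasurable hfm.aemeasurable hfin).1 ?_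
  have hfin' : IsFiniteMeasure (μ.withDensity fun x => condDistrib Y X P x B) :=
    isFiniteMeasure_withDensity hfin
  have hmap : (μ.withDensity fun x => condDistrib Y X P x B).map incr =
      (μ.withDensity f).map incr := by
    refine ext_of_generate_finite _ generateFrom_pi.symm isPiSystem_pi ?_ ?_
    · rintro _ ⟨A, hA, rfl⟩
      have hA : ∀ s, MeasurableSet (A s) := fun s => hA s (Set.mem_univ _)
      rw [Measure.map_apply measurable_incr (.univ_pi hA),
        Measure.map_apply measurable_incr (.univ_pi hA)]
      exact key A hA
    · have := key (fun _ => Set.univ) fun _ => .univ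
      rw [Measure.map_apply measurable_incr .univ, Measure.map_apply measurable_incr .univ]
      simpa using this
  have := congrArg (Measure.map cumsum) hmap
  rw [Measure.map_map measurable_cumsum measurable_incr,
    Measure.map_map measurable_cumsum measurable_incr] at this
  have e : (cumsum ∘ incr : Path (N + 1) → Path (N + 1)) = id := funext cumsum_incr
  rwa [e, Measure.map_id, Measure.map_id] at this

end Causal

section

variable {N : ℕ} {μ ν : Measure (Path (N + 1))} [IsProbabilityMeasure μ]

/-! ### Bicausal modification of a causal plan -/

/-- Under independent increments each causal plan can be replaced by a bicausal one with the same
joint laws of simultaneous increments. -/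
lemma HasIndependentIncrements.exists_bicausal (hμ : HasIndependentIncrements μ)
    [IsProbabilityMeasure ν] {γ : Measure (Path (N + 1) × Path (N + 1))}
    (hγ : γ ∈ causalPlans μ ν) :
    ∃ γ' ∈ bicausalPlans μ ν, ∀ t, γ'.map (fun p => (incr p.1 t, incr p.2 t)) =
      γ.map (fun p => (incr p.1 t, incr p.2 t)) := by
  have hγp : IsProbabilityMeasure γ := isProbabilityMeasure_of_mem_plans hγ.1
  set Z : ∀ t : Fin (N + 1), Path (N + 1) → (Set.Iio t → ℝ) × ℝ := fun t y => (past t y, y t)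
    with hZ
  have hZm : ∀ t, Measurable (Z t) := fun t => (measurable_past t).prodMk (measurable_pi_apply t)
  -- Each increment is redrawn given `y` up to and including time `t`; including `y t` is what
  -- preserves the joint law of the simultaneous increments.
  set κ : ∀ t : Fin (N + 1), Kernel ((Set.Iio t → ℝ) × ℝ) ℝ := fun t =>
    condDistrib (fun p : Path (N + 1) × Path (N + 1) => incr p.1 t) (fun p => Z t p.2) γ with hκ
  set P : Measure (Path (N + 1) × Path (N + 1)) := ν.prod (unifPi (N + 1)) with hP
  set d : Path (N + 1) × Path (N + 1) → Path (N + 1) := fun ω t =>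
    quantile (κ t (Z t ω.1)) (ω.2 t) with hd
  have hv : ∀ t, Measurable fun ω : Path (N + 1) × Path (N + 1) => ω.2 t := fun t =>
    (measurable_pi_apply t).comp measurable_snd
  have hdm : Measurable d := measurable_pi_iff.2 fun t =>
    (measurable_quantile_kernel (κ t)).comp (((hZm t).comp measurable_fst).prodMk (hv t))
  have hsnd : P.map (fun ω => ω.2) = unifPi (N + 1) := Measure.snd_prod
  have hfst : P.map (fun ω => ω.1) = ν := Measure.fst_prod
  have hvlaw : ∀ t, P.map (fun ω => ω.2 t) = unif := fun t => by
    rw [← map_eval_unifPi t, ← hsnd, Measure.map_map (measurable_pi_apply t) measurable_snd]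
    rfl
  have hjoint : ∀ t, P.map (fun ω => (Z t ω.1, d ω t)) = γ.map (fun p => (Z t p.2, incr p.1 t)) := by
    intro t
    have hind : IndepFun (fun ω => Z t ω.1) (fun ω => ω.2 t) P :=
      indepFun_prod (hZm t) (measurable_pi_apply t)
    have h1 := map_prodMk_quantile (Z := fun ω => Z t ω.1) (by fun_prop) (hv t) hind (hvlaw t) (κ t)
    have h2 : P.map (fun ω => Z t ω.1) = γ.map (fun p => Z t p.2) := by
      have := congrArg (Measure.map (Z t)) (hfst.trans hγ.1.2.symm)
      rwa [Measure.map_map (hZm t) measurable_fst, Measure.map_map (hZm t) measurable_snd] at this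
    rw [h2] at h1
    refine h1.trans ?_
    exact compProd_map_condDistrib (by fun_prop)
  have hlaw : ∀ t, P.map (fun ω => d ω t) = μ.map fun x => incr x t := by
    intro t
    have := congrArg (Measure.map Prod.snd) (hjoint t)
    rw [Measure.map_map measurable_snd (by fun_prop), Measure.map_map measurable_snd (by fun_prop)]
      at this
    refine this.trans ?_
    rw [← hγ.1.1, Measure.map_map (by fun_prop) measurable_fst]
    rfl
  -- This independence concerns only the law in `hjoint`, and it holds under `γ` by causality.
  have hAD : ∀ t, IndepFun (fun ω => past t ω.1) (fun ω => d ω t) P := by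
    intro t
    have hm : Measurable fun p : ((Set.Iio t → ℝ) × ℝ) × ℝ => (p.1.1, p.2) := by fun_prop
    have h1 := congrArg (Measure.map fun p => (p.1.1, p.2)) (hjoint t)
    rw [Measure.map_map hm (by fun_prop), Measure.map_map hm (by fun_prop)] at h1
    have h2 := hμ.indepFun_of_mem_causalPlans hγ t
    rw [indepFun_iff_map_prod_eq_prod_map_map (by fun_prop) (by fun_prop)] at h2 ⊢
    have h3 : P.map (fun ω => past t ω.1) = γ.map (fun p => past t p.2) := by
      have := congrArg (Measure.map (past t)) (hfst.trans hγ.1.2.symm)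
      rwa [Measure.map_map (measurable_past t) measurable_fst,
        Measure.map_map (measurable_past t) measurable_snd] at this
    have h4 : P.map (fun ω => d ω t) = γ.map fun p => incr p.1 t := by
      rw [hlaw, ← hγ.1.1, Measure.map_map (by fun_prop) measurable_fst]
      rfl
    rw [h3, h4, ← h2]
    exact h1
  -- The past noise is independent of `(past y, d t)`, which uses only `y` and the noise at `t`.
  -- With `hAD` this makes `d t` independent of the past of `y` and of the noise together, and the
  -- past of `d` is a function of these two.
  have hind : ∀ t, IndepFun (fun ω => (past t (d ω), past t ω.1)) (fun ω => d ω t) P := by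
    intro t
    have h1 : IndepFun (fun ω => (ω.2 t, ω.1)) (fun ω => past t ω.2) P := by
      refine indepFun_prodMk_of_indepFun (hv t) (by fun_prop) measurable_fst ?_ ?_
      · exact (indepFun_prod (X := id) (Y := fun v : Path (N + 1) => (v t, past t v))
          measurable_id (by fun_prop)).symm
      · have h := (indepFun_past_unifPi t).symm
        rw [indepFun_iff_map_prod_eq_prod_map_map (measurable_pi_apply t).aemeasurable
          (by fun_prop)] at h
        rw [indepFun_iff_map_prod_eq_prod_map_map (hv t).aemeasurable (by fun_prop)]
        rw [← hsnd, Measure.map_map ((measurable_pi_apply t).prodMk (measurable_past t)) measurable_snd,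
          Measure.map_map (measurable_pi_apply t) measurable_snd,
          Measure.map_map (measurable_past t) measurable_snd] at h
        exact h
    have h2 : IndepFun (fun ω => (past t ω.1, d ω t)) (fun ω => past t ω.2) P :=
      h1.comp (φ := fun q : ℝ × Path (N + 1) => (past t q.2, quantile (κ t (Z t q.2)) q.1))
        (ψ := id) ((by fun_prop : Measurable fun q : ℝ × Path (N + 1) => past t q.2).prodMk
          ((measurable_quantile_kernel (κ t)).comp
            (((hZm t).comp measurable_snd).prodMk measurable_fst))) measurable_id
    have h3 := indepFun_prodMk_of_indepFun (by fun_prop) (by fun_prop) (by fun_prop) h2 (hAD t)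
    have hΦ : Measurable fun q : (Set.Iio t → ℝ) × (Set.Iio t → ℝ) =>
        (past t (d (extend t q.1, extend t q.2)), q.1) := by fun_prop
    have h4 := h3.comp (ψ := id) hΦ measurable_id
    have e : (fun q : (Set.Iio t → ℝ) × (Set.Iio t → ℝ) =>
        (past t (d (extend t q.1, extend t q.2)), q.1)) ∘
        (fun ω : Path (N + 1) × Path (N + 1) => (past t ω.1, past t ω.2)) =
        fun ω => (past t (d ω), past t ω.1) := by
      funext ω
      simp only [Function.comp_apply, Prod.mk.injEq, and_true]
      refine past_congr fun s hs => ?_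
      simp only [hd, hZ]
      rw [extend_past_apply hs, extend_past_apply hs,
        past_congr fun r hr => extend_past_apply (lt_trans hr hs) ω.1]
    rw [e] at h4
    exact h4
  have hmem := hμ.map_mem_causalPlans hdm measurable_fst hlaw hind hfst
  refine ⟨_, ⟨hmem, ?_⟩, fun t => ?_⟩
  -- Causality from `y` to `x`: the new path is an adapted function of `y` and of noise independent
  -- of `y`.
  · have hΨ : Measurable fun ω => cumsum (d ω) := by fun_prop
    rw [Measure.map_map measurable_swap (by fun_prop)]
    refine map_mem_causalPlans_of_adapted (μ := ν) (unifPi (N + 1))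
      (Ψ := fun ω => cumsum (d ω)) hΨ ?_ ?_
    · intro t x x' v hx s hs
      refine cumsum_congr fun r hr => ?_
      simp only [hd, hZ]
      rw [hx r (hr.trans hs), past_congr fun q hq => hx q (hq.le.trans (hr.trans hs))]
    · have := hmem.1.1
      rwa [Measure.map_map measurable_fst (by fun_prop)] at this
  · have hm : Measurable fun p : ((Set.Iio t → ℝ) × ℝ) × ℝ => (p.2, p.1.2 - prev t p.1.1) := by
      fun_prop
    have h1 := congrArg (Measure.map fun p => (p.2, p.1.2 - prev t p.1.1)) (hjoint t)
    rw [Measure.map_map hm (by fun_prop), Measure.map_map hm (by fun_prop)] at h1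
    rw [Measure.map_map (by fun_prop) (by fun_prop)]
    simp only [Function.comp_def, incr_cumsum]
    simp only [Function.comp_def, hZ, ← incr_eq_sub_prev] at h1
    exact h1

/-! ### The Knothe-Rosenblatt rearrangement -/

lemma HasIndependentIncrements.knotheRosenblatt_eq (hμ : HasIndependentIncrements μ)
    [IsProbabilityMeasure ν] : knotheRosenblatt μ ν = (unifPi (N + 1)).map fun u =>
      (cumsum fun t => quantile (μ.map fun x => incr x t) (u t), quantileTransform ν u) := by
  refine Measure.map_congr ?_
  filter_upwards [hμ.quantileTransform_ae_eq] with u hu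
  rw [hu]

lemma measurable_quantile_incr :
    Measurable fun (u : Path (N + 1)) (t : Fin (N + 1)) =>
      quantile (μ.map fun x : Path (N + 1) => incr x t) (u t) := by
  refine measurable_pi_iff.2 fun t => ?_
  have : IsProbabilityMeasure (μ.map fun x => incr x t) :=
    Measure.isProbabilityMeasure_map (by fun_prop)
  exact (measurable_quantile _).comp (measurable_pi_apply t)

/-- Before time `t` both processes are functions of the earlier uniforms, whereas the increment of
`x` at `t` is a function of `u t` alone. -/
lemma HasIndependentIncrements.knotheRosenblatt_mem_causalPlans
    (hμ : HasIndependentIncrements μ) [IsProbabilityMeasure ν] :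
    knotheRosenblatt μ ν ∈ causalPlans μ ν := by
  rw [hμ.knotheRosenblatt_eq]
  have hρ : ∀ t, IsProbabilityMeasure (μ.map fun x : Path (N + 1) => incr x t) := fun t =>
    Measure.isProbabilityMeasure_map (by fun_prop)
  have hdm := measurable_quantile_incr (μ := μ)
  refine hμ.map_mem_causalPlans hdm (measurable_quantileTransform ν) (fun t => ?_) (fun t => ?_)
    (map_quantileTransform ν)
  · have := Measure.map_map (μ := unifPi (N + 1)) (measurable_quantile (μ.map fun x => incr x t))
      (measurable_pi_apply t)
    rw [map_eval_unifPi, map_quantile_unif] at this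
    exact this.symm
  · set φ : (Set.Iio t → ℝ) → (Set.Iio t → ℝ) × (Set.Iio t → ℝ) := fun w =>
      (past t (fun s => quantile (μ.map fun x => incr x s) (extend t w s)),
        past t (quantileTransform ν (extend t w))) with hφ
    have hφm : Measurable φ :=
      ((measurable_past t).comp (hdm.comp (measurable_extend t))).prodMk (by fun_prop)
    have e : φ ∘ past t = fun u : Path (N + 1) =>
        (past t (fun t => quantile (μ.map fun x => incr x t) (u t)),
          past t (quantileTransform ν u)) := by
      funext u
      refine Prod.ext ?_ (past_quantileTransform ν u t).symm
      refine funext fun s => ?_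
      change quantile _ (extend t (past t u) s.1) = quantile _ (u s.1)
      rw [extend_past_apply s.2]
    have h := (indepFun_past_unifPi t).comp hφm
      (measurable_quantile (μ.map fun x : Path (N + 1) => incr x t))
    rw [e] at h
    exact h

/-- The Knothe-Rosenblatt rearrangement is optimal for each increment. -/
lemma HasIndependentIncrements.lintegral_knotheRosenblatt_le (hμ : HasIndependentIncrements μ)
    [IsProbabilityMeasure ν] {γ : Measure (Path (N + 1) × Path (N + 1))}
    (hγ : γ ∈ causalPlans μ ν) {g : ℝ → ℝ≥0∞} (hg : ENNConvex g) (hlsc : LowerSemicontinuous g)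
    (t : Fin (N + 1)) :
    ∫⁻ p, g (incr p.1 t - incr p.2 t) ∂(knotheRosenblatt μ ν) ≤
      ∫⁻ p, g (incr p.1 t - incr p.2 t) ∂γ := by
  have hγp : IsProbabilityMeasure γ := isProbabilityMeasure_of_mem_plans hγ.1
  have hgm : Measurable g := hlsc.measurable
  set ρ := μ.map fun x : Path (N + 1) => incr x t with hρ
  have hρp : IsProbabilityMeasure ρ := Measure.isProbabilityMeasure_map (by fun_prop)
  set η := ν.map (past t) with hη
  have hηp : IsProbabilityMeasure η := Measure.isProbabilityMeasure_map (by fun_prop)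
  have hyt : Measurable fun p : Path (N + 1) × Path (N + 1) => p.2 t :=
    (measurable_pi_apply t).comp measurable_snd
  have hγη : γ.map (fun p => past t p.2) = η := by
    rw [hη, ← hγ.1.2, Measure.map_map (by fun_prop) measurable_snd]; rfl
  have hγρ : γ.map (fun p => incr p.1 t) = ρ := by
    rw [hρ, ← hγ.1.1, Measure.map_map (by fun_prop) measurable_fst]; rfl
  have hq := measurable_quantile_kernel (condLaw ν t)
  have hqρ := measurable_quantile ρ
  -- the left-hand side
  have hL : ∫⁻ p, g (incr p.1 t - incr p.2 t) ∂(knotheRosenblatt μ ν) =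
      ∫⁻ w, ∫⁻ u, g (quantile ρ u - (quantile (condLaw ν t w) u - prev t w)) ∂unif ∂η := by
    have hdm := measurable_quantile_incr (μ := μ)
    have hmap : Measurable fun u : Path (N + 1) =>
        (cumsum fun t => quantile (μ.map fun x : Path (N + 1) => incr x t) (u t),
          quantileTransform ν u) :=
      (measurable_cumsum.comp hdm).prodMk (measurable_quantileTransform ν)
    rw [hμ.knotheRosenblatt_eq, lintegral_map (by fun_prop) hmap]
    simp only [incr_cumsum]
    have hF : Measurable fun q : (Set.Iio t → ℝ) × ℝ =>
        g (quantile ρ q.2 - (quantile (condLaw ν t q.1) q.2 - prev t q.1)) := by fun_prop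
    have hprod := (indepFun_iff_map_prod_eq_prod_map_map (by fun_prop)
      (measurable_pi_apply t).aemeasurable).1 (indepFun_past_quantileTransform ν t)
    rw [map_past_quantileTransform, map_eval_unifPi] at hprod
    rw [← lintegral_prod _ hF.aemeasurable, ← hprod, lintegral_map hF
      ((by fun_prop : Measurable fun u => past t (quantileTransform ν u)).prodMk
        (measurable_pi_apply t))]
    refine lintegral_congr fun u => ?_
    rw [incr_eq_sub_prev (quantileTransform ν u), quantileTransform_apply]
  set V : Path (N + 1) × Path (N + 1) → ℝ × ℝ := fun p => (incr p.1 t, p.2 t) with hV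
  have hVm : Measurable V := by fun_prop
  set π := condDistrib V (fun p => past t p.2) γ with hπ
  have hR : ∫⁻ p, g (incr p.1 t - incr p.2 t) ∂γ =
      ∫⁻ w, ∫⁻ v, g (v.1 - (v.2 - prev t w)) ∂(π w) ∂η := by
    have hF : Measurable fun q : (Set.Iio t → ℝ) × (ℝ × ℝ) =>
        g (q.2.1 - (q.2.2 - prev t q.1)) := by fun_prop
    rw [← Measure.lintegral_compProd (f := fun q : (Set.Iio t → ℝ) × (ℝ × ℝ) =>
      g (q.2.1 - (q.2.2 - prev t q.1))) hF, ← hγη, hπ,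
      compProd_map_condDistrib hVm.aemeasurable, lintegral_map hF (by fun_prop)]
    refine lintegral_congr fun p => ?_
    rw [incr_eq_sub_prev p.2]
  -- Causality enters here: conditioning on the past of `y` leaves the law of the increment of `x`
  -- unchanged.
  have h1 : ∀ᵐ w ∂η, (π w).map Prod.fst = ρ := by
    have e1 := condDistrib_comp (mβ := MeasurableSpace.pi) (μ := γ) (fun p => past t p.2) hVm.aemeasurable measurable_fst
    have e2 := condDistrib_ae_eq_of_measure_eq_compProd (μ := γ) (Y := Prod.fst ∘ V)
      (fun p => past t p.2) (by fun_prop) (κ := Kernel.const _ ρ) (by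
        rw [Measure.compProd_const, ← hγρ]
        exact (indepFun_iff_map_prod_eq_prod_map_map (by fun_prop) (by fun_prop)).1
          (hμ.indepFun_of_mem_causalPlans hγ t))
    rw [hγη] at e1 e2
    filter_upwards [e1, e2] with w hw1 hw2
    rw [hπ, ← Kernel.map_apply _ measurable_fst, ← hw1, hw2, Kernel.const_apply]
  have h2 : ∀ᵐ w ∂η, (π w).map Prod.snd = condLaw ν t w := by
    have e1 := condDistrib_comp (mβ := MeasurableSpace.pi) (μ := γ) (fun p => past t p.2) hVm.aemeasurable measurable_snd
    have e2 := condDistrib_ae_eq_of_measure_eq_compProd (μ := γ) (Y := Prod.snd ∘ V)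
      (fun p => past t p.2) (by fun_prop) (κ := condLaw ν t) (by
        rw [hγη]
        refine Eq.trans ?_ (compProd_map_condDistrib (X := past t)
          (measurable_pi_apply t).aemeasurable).symm
        rw [← hγ.1.2, Measure.map_map (by fun_prop) measurable_snd]
        rfl)
    rw [hγη] at e1 e2
    filter_upwards [e1, e2] with w hw1 hw2
    rw [hπ, ← Kernel.map_apply _ measurable_snd, ← hw1, hw2]
  rw [hL, hR]
  refine lintegral_mono_ae ?_
  filter_upwards [h1, h2] with w hw1 hw2
  have hm : Measurable fun b : ℝ => b - prev t w := by fun_prop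
  -- For a fixed past `w` this is a problem on the line between `ρ` and the conditional law of `y t`
  -- translated by `-prev t w`.
  refine hg.lintegral_sub_le hlsc (X := fun v : ℝ × ℝ => v.1)
    (Y := fun v : ℝ × ℝ => v.2 - prev t w) (by fun_prop) (by fun_prop) hqρ
    ((measurable_quantile (condLaw ν t w)).sub_const _) (monotoneOn_quantile ρ) ?_ ?_ ?_
  · intro a ha b hb hab
    exact sub_le_sub_right (monotoneOn_quantile (condLaw ν t w) ha hb hab) _
  · rw [map_quantile_unif]; exact hw1.symm
  · have e1 := Measure.map_map (μ := unif) hm (measurable_quantile (condLaw ν t w))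
    have e2 := Measure.map_map (μ := π w) hm measurable_snd
    rw [map_quantile_unif] at e1
    rw [hw2] at e2
    exact e1.symm.trans e2

/-! ### The Knothe-Rosenblatt map -/

section Monge

variable [IsProbabilityMeasure ν]

lemma knotheRosenblattMap_apply (x : Path (N + 1)) (t : Fin (N + 1)) :
    knotheRosenblattMap μ ν x t = quantile (condLaw ν t (past t (knotheRosenblattMap μ ν x)))
      (cdf (condLaw μ t (past t x)) (x t)) := by
  rw [knotheRosenblattMap]
  rfl

lemma measurable_knotheRosenblattMap : Measurable (knotheRosenblattMap μ ν) := by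
  refine measurable_pi_iff.2 fun t => ?_
  induction t using WellFoundedLT.induction with
  | _ t ih =>
    simp_rw [knotheRosenblattMap_apply _ t]
    refine (measurable_quantile_kernel (condLaw ν t)).comp (Measurable.prodMk ?_ ?_)
    · exact measurable_pi_iff.2 fun s => ih s.1 s.2
    · exact (measurable_cdf_kernel (condLaw μ t)).comp
        ((measurable_past t).prodMk (measurable_pi_apply t))

/-- Conditional laws of `μ` are translates of atomless laws, so their distribution functions return
`u t` at the quantile; the recursion for `T` along `X*` then coincides with the one for `Y*`. -/
lemma HasIndependentIncrements.knotheRosenblattMap_quantileTransform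
    (hμ : HasIndependentIncrements μ)
    (hatom : ∀ t, NullSingletonClass (μ.map fun x => incr x t)) :
    ∀ᵐ u ∂(unifPi (N + 1)),
      knotheRosenblattMap μ ν (quantileTransform μ u) = quantileTransform ν u := by
  filter_upwards [unifPi_ae_mem_Ioo, hμ.condLaw_quantileTransform_ae_eq] with u hu1 hu2
  funext t
  induction t using WellFoundedLT.induction with
  | _ t ih =>
    have hnull : NullSingletonClass (condLaw μ t (past t (quantileTransform μ u))) := by
      constructor
      intro x
      rw [hu2 t, Measure.map_apply (by fun_prop) (measurableSet_singleton x)]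
      have : (fun y => y + prev t (past t (quantileTransform μ u))) ⁻¹' {x} =
          {x - prev t (past t (quantileTransform μ u))} := by
        ext y; exact eq_sub_iff_add_eq.symm
      rw [this]
      exact (hatom t).measure_singleton _
    rw [knotheRosenblattMap_apply, past_congr fun s hs => ih s hs, quantileTransform_apply μ u t,
      cdf_quantile _ (hu1 t), ← quantileTransform_apply]

lemma HasIndependentIncrements.knotheRosenblatt_eq_map (hμ : HasIndependentIncrements μ)
    (hatom : ∀ t, NullSingletonClass (μ.map fun x => incr x t)) :
    knotheRosenblatt μ ν = μ.map (fun x => (x, knotheRosenblattMap μ ν x)) := by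
  have hm : Measurable fun x => (x, knotheRosenblattMap μ ν x) :=
    measurable_id.prodMk measurable_knotheRosenblattMap
  have e : μ.map (fun x => (x, knotheRosenblattMap μ ν x)) =
      (unifPi (N + 1)).map
        (fun u => (quantileTransform μ u, knotheRosenblattMap μ ν (quantileTransform μ u))) := by
    refine Eq.trans ?_ (Measure.map_map hm (measurable_quantileTransform μ))
    rw [map_quantileTransform]
  rw [e]
  refine Measure.map_congr ?_
  filter_upwards [hμ.knotheRosenblattMap_quantileTransform (ν := ν) hatom] with u hu
  rw [hu]

end Monge

end

/-! ### Costs -/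

lemma ereal_sum_ne_bot {ι : Type*} {f : ι → EReal} (h : ∀ i, f i ≠ ⊥) (s : Finset ι) :
    ∑ i ∈ s, f i ≠ ⊥ := by
  classical
  induction s using Finset.induction_on with
  | empty => simp
  | insert a s ha ih => rw [Finset.sum_insert ha]; exact EReal.add_ne_bot_iff.2 ⟨h a, ih⟩

lemma ereal_sum_ne_top {ι : Type*} {f : ι → EReal} (h : ∀ i, f i ≠ ⊤) (s : Finset ι) :
    ∑ i ∈ s, f i ≠ ⊤ := by
  classical
  induction s using Finset.induction_on with
  | empty => simp
  | insert a s ha ih => rw [Finset.sum_insert ha]; exact EReal.add_ne_top (h a) ih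

lemma ereal_add_sub_coe (x : EReal) (r : ℝ) : x + r - r = x := by
  induction x with
  | bot => rfl
  | top => rfl
  | coe x => norm_cast; ring

lemma ereal_coe_add_sub_coe (x : EReal) (r : ℝ) : r + (x - r) = x := by
  induction x with
  | bot => rfl
  | top => rfl
  | coe x => norm_cast; ring

lemma continuous_ereal_sub_coe (r : ℝ) : Continuous fun x : EReal => x - r := by
  rw [continuous_iff_continuousAt]
  intro x
  have h := EReal.continuousAt_add (p := (x, ((-r : ℝ) : EReal))) (Or.inr (EReal.coe_ne_bot _))
    (Or.inr (EReal.coe_ne_top _))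
  have h2 : ContinuousAt (fun x : EReal => (x, ((-r : ℝ) : EReal))) x := by fun_prop
  exact ContinuousAt.comp (f := fun x : EReal => (x, ((-r : ℝ) : EReal))) h h2

lemma monotone_ereal_sub_coe (r : ℝ) : Monotone fun x : EReal => x - r :=
  fun _ _ h => EReal.sub_le_sub h le_rfl

/-- Integration of a function that is bounded from below. -/
lemma extIntegral_coe_add {α : Type*} [MeasurableSpace α] (μ : Measure α) [IsProbabilityMeasure μ]
    (K : ℝ) {G : α → ℝ≥0∞} (hG : Measurable G) :
    extIntegral μ (fun x => (K : EReal) + G x) = K + (∫⁻ x, G x ∂μ : ℝ≥0∞) := by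
  unfold extIntegral
  set a : α → ℝ≥0∞ := fun x => ((K : EReal) + G x).toENNReal with ha
  set b : α → ℝ≥0∞ := fun x => (-((K : EReal) + G x)).toENNReal with hb
  have hGe : Measurable fun x => (G x : EReal) := measurable_coe_ennreal_ereal.comp hG
  have hbm : Measurable b := (Measurable.neg (measurable_const.add hGe)).ereal_toENNReal
  -- Positive and negative parts are balanced additively in `[0, ∞]`, which avoids subtracting
  -- infinities. Only `b`, bounded by the negative part of `K`, has to have a finite integral.
  have hpt : ∀ x, G x + ENNReal.ofReal K + b x = a x + ENNReal.ofReal (-K) := by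
    intro x
    rcases eq_or_ne (G x) ⊤ with h | h
    · simp [ha, h]
    · simp only [ha, hb]
      lift G x to NNReal using h with g
      have e : (K : EReal) + ((g : ℝ≥0∞) : EReal) = ((K + g : ℝ) : EReal) := by norm_cast
      have e2 : -(((K + g : ℝ)) : EReal) = ((-(K + g) : ℝ) : EReal) := by norm_cast
      rw [e, e2, EReal.real_coe_toENNReal, EReal.real_coe_toENNReal, ← ENNReal.ofReal_coe_nnreal]
      have hg0 := g.coe_nonneg
      rcases le_total 0 K with h1 | h1
      · rw [ENNReal.ofReal_of_nonpos (show -K ≤ 0 by linarith),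
          ENNReal.ofReal_of_nonpos (show -(K + (g : ℝ)) ≤ 0 by linarith), add_zero, add_zero,
          ← ENNReal.ofReal_add hg0 h1, add_comm]
      · rw [ENNReal.ofReal_of_nonpos h1, add_zero]
        rcases le_total 0 (K + (g : ℝ)) with h2 | h2
        · rw [ENNReal.ofReal_of_nonpos (show -(K + (g : ℝ)) ≤ 0 by linarith), add_zero,
            ← ENNReal.ofReal_add h2 (by linarith)]
          congr 1; ring
        · rw [ENNReal.ofReal_of_nonpos h2, zero_add, ← ENNReal.ofReal_add hg0 (by linarith)]
          congr 1; ring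
  have hint : ∫⁻ x, G x ∂μ + ENNReal.ofReal K + ∫⁻ x, b x ∂μ =
      ∫⁻ x, a x ∂μ + ENNReal.ofReal (-K) := by
    have := lintegral_congr (μ := μ) hpt
    rw [lintegral_add_right _ hbm, lintegral_add_right _ measurable_const,
      lintegral_add_right _ measurable_const] at this
    simpa using this
  have hbK : ∀ x, b x ≤ ENNReal.ofReal (-K) := fun x => by
    rw [← EReal.real_coe_toENNReal]
    refine EReal.toENNReal_le_toENNReal ?_
    rw [EReal.coe_neg, EReal.neg_le_neg_iff]
    exact le_add_of_nonneg_right (EReal.coe_ennreal_nonneg _)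
  have hB : ∫⁻ x, b x ∂μ ≠ ⊤ := by
    refine ((lintegral_mono hbK).trans_lt ?_).ne
    simp
  generalize ∫⁻ x, G x ∂μ = I at *
  generalize ∫⁻ x, a x ∂μ = A at *
  generalize ∫⁻ x, b x ∂μ = B at *
  lift B to NNReal using hB
  rcases eq_or_ne I ⊤ with rfl | hI
  · have hA : A = ⊤ := by
      rw [top_add, top_add] at hint
      by_contra hA
      exact ENNReal.add_ne_top.2 ⟨hA, ENNReal.ofReal_ne_top⟩ hint.symm
    subst hA
    simp only [EReal.coe_ennreal_top, EReal.coe_add_top]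
    exact EReal.top_sub_coe B
  · have hA : A ≠ ⊤ := by
      rintro rfl
      rw [top_add] at hint
      exact ENNReal.add_ne_top.2 ⟨ENNReal.add_ne_top.2 ⟨hI, ENNReal.ofReal_ne_top⟩,
        ENNReal.coe_ne_top⟩ hint
    lift I to NNReal using hI
    lift A to NNReal using hA
    have hr := congrArg ENNReal.toReal hint
    rw [ENNReal.toReal_add (by simp) (by simp), ENNReal.toReal_add (by simp) (by simp),
      ENNReal.toReal_add (by simp) (by simp), ENNReal.toReal_ofReal', ENNReal.toReal_ofReal'] at hr
    simp only [ENNReal.coe_toReal] at hr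
    have hK : max K 0 - max (-K) 0 = K := by
      rcases le_total 0 K with h | h
      · rw [max_eq_left h, max_eq_right (by linarith)]; ring
      · rw [max_eq_right h, max_eq_left (by linarith)]; ring
    have hfin : (A : ℝ) - B = K + I := by linarith
    have e1 : ((A : ℝ≥0∞) : EReal) = ((A : ℝ) : EReal) := rfl
    have e2 : ((B : ℝ≥0∞) : EReal) = ((B : ℝ) : EReal) := rfl
    have e3 : ((I : ℝ≥0∞) : EReal) = ((I : ℝ) : EReal) := rfl
    rw [e1, e2, e3, ← EReal.coe_sub, ← EReal.coe_add, hfin]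

lemma extIntegral_top {α : Type*} [MeasurableSpace α] (μ : Measure α) [IsProbabilityMeasure μ] :
    extIntegral μ (fun _ => ⊤) = ⊤ := by
  simp [extIntegral]

lemma incrementCost_eq_sum {N : ℕ} (c : Fin (N + 1) → ℝ → ℝ → EReal)
    (p : Path (N + 1) × Path (N + 1)) :
    incrementCost c p = ∑ t, c t (incr p.1 t) (incr p.2 t) := by
  rw [Fin.sum_univ_succ]
  simp [incrementCost, incr]

lemma continuous_cumsum {N : ℕ} : Continuous (cumsum : Path (N + 1) → Path (N + 1)) :=
  continuous_pi fun t => by unfold cumsum; fun_prop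

/-! ### Reduction of the cost to its one-step terms -/

section Decomposition

variable {N : ℕ} {c : Fin (N + 1) → ℝ → ℝ → EReal}

lemma incrementCost_eq_top (hc_bot : ∀ t a b, c t a b ≠ ⊥) {t : Fin (N + 1)}
    (ht : ∀ a b, c t a b = ⊤) : incrementCost c = fun _ => ⊤ := by
  funext p
  rw [incrementCost_eq_sum, ← Finset.add_sum_erase _ _ (Finset.mem_univ t), ht]
  exact EReal.top_add_of_ne_bot (ereal_sum_ne_bot (fun s => hc_bot s _ _) _)

/-- The summands of a lower semicontinuous cost that is bounded from below inherit these
properties. -/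
lemma bddBelow_and_lowerSemicontinuous_of_incrementCost (hc_bot : ∀ t a b, c t a b ≠ ⊥)
    (hc_lsc : LowerSemicontinuous (incrementCost c))
    (hc_bdd : ∃ K : ℝ, ∀ p, (K : EReal) ≤ incrementCost c p)
    (hfin : ∀ t, ∃ a b, c t a b ≠ ⊤) (t : Fin (N + 1)) :
    (∃ K : ℝ, ∀ a b, (K : EReal) ≤ c t a b) ∧
      LowerSemicontinuous fun q : ℝ × ℝ => c t q.1 q.2 := by
  -- All increments except the one at `t` are frozen at values of finite cost; along this slice the
  -- total cost is `c t` plus the real constant `R`.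
  choose a b hab using hfin
  obtain ⟨R, hR⟩ : ∃ R : ℝ, ∑ s ∈ Finset.univ.erase t, c s (a s) (b s) = R :=
    ⟨_, (EReal.coe_toReal (ereal_sum_ne_top hab _)
      (ereal_sum_ne_bot (fun s => hc_bot s _ _) _)).symm⟩
  set F : ℝ × ℝ → Path (N + 1) × Path (N + 1) := fun q =>
    (cumsum (Function.update a t q.1), cumsum (Function.update b t q.2)) with hF
  have hFc : Continuous F :=
    (continuous_cumsum.comp (continuous_const.update t continuous_fst)).prodMk
      (continuous_cumsum.comp (continuous_const.update t continuous_snd))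
  have hcF : ∀ q, incrementCost c (F q) = c t q.1 q.2 + R := by
    intro q
    rw [incrementCost_eq_sum, ← Finset.add_sum_erase _ _ (Finset.mem_univ t), ← hR]
    simp only [hF, incr_cumsum, Function.update_self]
    congr 1
    refine Finset.sum_congr rfl fun s hs => ?_
    have hst := Finset.ne_of_mem_erase hs
    rw [Function.update_of_ne hst, Function.update_of_ne hst]
  have hct : ∀ q : ℝ × ℝ, c t q.1 q.2 = incrementCost c (F q) - R := fun q => by
    rw [hcF, ereal_add_sub_coe]
  refine ⟨?_, ?_⟩
  · obtain ⟨K, hK⟩ := hc_bdd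
    refine ⟨K - R, fun x y => ?_⟩
    rw [hct (x, y), EReal.coe_sub]
    exact monotone_ereal_sub_coe R (hK _)
  · simp_rw [hct]
    exact (continuous_ereal_sub_coe R).comp_lowerSemicontinuous (hc_lsc.comp hFc)
      (monotone_ereal_sub_coe R)

/-- Shows that the value of a plan depends only on its joint laws of simultaneous increments, and
reduces comparisons of plans to single times. -/
lemma extIntegral_incrementCost {K : Fin (N + 1) → ℝ} {g : Fin (N + 1) → ℝ → ℝ → ℝ≥0∞}
    (hg : ∀ t, Measurable fun q : ℝ × ℝ => g t q.1 q.2)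
    (hc : ∀ t a b, c t a b = K t + (g t a b : EReal))
    (γ : Measure (Path (N + 1) × Path (N + 1))) [IsProbabilityMeasure γ] :
    extIntegral γ (incrementCost c) =
      ((∑ t, K t : ℝ) : EReal) + (∑ t, ∫⁻ p, g t (incr p.1 t) (incr p.2 t) ∂γ : ℝ≥0∞) := by
  have hm : ∀ t, Measurable fun p : Path (N + 1) × Path (N + 1) =>
      g t (incr p.1 t) (incr p.2 t) := fun t => (hg t).comp
    (((measurable_incr_apply t).comp measurable_fst).prodMk
      ((measurable_incr_apply t).comp measurable_snd))
  have e : incrementCost c = fun p => ((∑ t, K t : ℝ) : EReal) +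
      (∑ t, g t (incr p.1 t) (incr p.2 t) : ℝ≥0∞) := by
    funext p
    rw [incrementCost_eq_sum]
    simp_rw [hc]
    rw [Finset.sum_add_distrib]
    congr 1
    · exact (map_sum (⟨⟨Real.toEReal, rfl⟩, EReal.coe_add⟩ : ℝ →+ EReal) _ _).symm
    · exact (map_sum (⟨⟨ENNReal.toEReal, rfl⟩, EReal.coe_ennreal_add⟩ : ℝ≥0∞ →+ EReal) _ _).symm
  rw [e, extIntegral_coe_add _ _ (Finset.measurable_sum _ fun t _ => hm t),
    lintegral_finsetSum _ fun t _ => hm t]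

end Decomposition

/-- The weights sum to 1, so the constant `K` cancels. -/
lemma IsConvex.ennConvex {h : ℝ → EReal} (hh : IsConvex h) {K : ℝ} {G : ℝ → ℝ≥0∞}
    (hG : ∀ z, h z = K + (G z : EReal)) : ENNConvex G := by
  intro x y a b ha hb hab
  rcases eq_or_ne (G x) ⊤ with hx | hx
  · simp [hx, ENNReal.mul_top, ha]
  rcases eq_or_ne (G y) ⊤ with hy | hy
  · simp [hy, ENNReal.mul_top, hb]
  have h1 := hh x y a b ha hb hab
  rw [hG, hG, hG] at h1
  have hfin : ENNReal.ofReal a * G x + ENNReal.ofReal b * G y ≠ ⊤ :=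
    ENNReal.add_ne_top.2 ⟨ENNReal.mul_ne_top ENNReal.ofReal_ne_top hx,
      ENNReal.mul_ne_top ENNReal.ofReal_ne_top hy⟩
  have e : (a : EReal) * (K + (G x : EReal)) + b * (K + (G y : EReal)) =
      K + ((ENNReal.ofReal a * G x + ENNReal.ofReal b * G y : ℝ≥0∞) : EReal) := by
    lift G x to NNReal using hx with gx
    lift G y to NNReal using hy with gy
    lift a to NNReal using ha.le
    lift b to NNReal using hb.le
    rw [ENNReal.ofReal_coe_nnreal, ENNReal.ofReal_coe_nnreal]
    have e1 : ((gx : ℝ≥0∞) : EReal) = ((gx : ℝ) : EReal) := rfl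
    have e2 : ((gy : ℝ≥0∞) : EReal) = ((gy : ℝ) : EReal) := rfl
    have e3 : ((a * gx + b * gy : ℝ≥0∞) : EReal) = ((a * gx + b * gy : ℝ) : EReal) := by
      norm_cast
    rw [e1, e2, e3]
    norm_cast
    push_cast
    linear_combination (K : ℝ) * hab
  rw [e] at h1
  have h2 := monotone_ereal_sub_coe K h1
  simp only [add_comm (K : EReal), ereal_add_sub_coe] at h2
  exact EReal.coe_ennreal_le_coe_ennreal_iff.1 h2

end CausalTransport

/-! ### Assembly of the three claims -/

open CausalTransport in
theorem mainTheorem5 (N : ℕ)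
    (μ ν : MeasureTheory.Measure (CausalTransport.Path (N + 1)))
    [MeasureTheory.IsProbabilityMeasure μ] [MeasureTheory.IsProbabilityMeasure ν]
    (hμ : CausalTransport.HasIndependentIncrements μ)
    (c : Fin (N + 1) → ℝ → ℝ → EReal)
    (hc_bot : ∀ t a b, c t a b ≠ ⊥)
    (hc_lsc : LowerSemicontinuous (CausalTransport.incrementCost c))
    (hc_bdd : ∃ K : ℝ, ∀ p, (K : EReal) ≤ CausalTransport.incrementCost c p) :
    CausalTransport.causalValue μ ν (CausalTransport.incrementCost c) =
        CausalTransport.bicausalValue μ ν (CausalTransport.incrementCost c) ∧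
      ((∃ h : Fin (N + 1) → ℝ → EReal,
          (∀ t, CausalTransport.IsConvex (h t)) ∧ ∀ t a b, c t a b = h t (a - b)) →
        CausalTransport.IsCausalOptimal μ ν (CausalTransport.incrementCost c)
          (CausalTransport.knotheRosenblatt μ ν)) ∧
      ((∀ t, MeasureTheory.NullSingletonClass (μ.map fun x => CausalTransport.incr x t)) →
        Measurable (CausalTransport.knotheRosenblattMap μ ν) ∧
        μ.map (CausalTransport.knotheRosenblattMap μ ν) = ν ∧
        CausalTransport.knotheRosenblatt μ ν =
          μ.map (fun x => (x, CausalTransport.knotheRosenblattMap μ ν x))) := by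
  have hKR := hμ.knotheRosenblatt_mem_causalPlans (ν := ν)
  refine ⟨?_, ?_, ?_⟩
  · refine le_antisymm (biInf_mono fun γ hγ => hγ.1) (le_iInf₂ fun γ hγ => ?_)
    have hγp := isProbabilityMeasure_of_mem_plans hγ.1
    -- If some summand is identically `⊤`, so is the cost, and all plans have value `⊤`; otherwise
    -- each summand is itself bounded below and lower semicontinuous.
    by_cases hfin : ∀ t, ∃ a b, c t a b ≠ ⊤
    · obtain ⟨γ', hγ', hlaw⟩ := hμ.exists_bicausal hγ
      have hγp' := isProbabilityMeasure_of_mem_plans hγ'.1.1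
      refine (iInf₂_le γ' hγ').trans_eq ?_
      have hd := bddBelow_and_lowerSemicontinuous_of_incrementCost hc_bot hc_lsc hc_bdd hfin
      choose K hK using fun t => (hd t).1
      have hgm : ∀ t, Measurable fun q : ℝ × ℝ => (c t q.1 q.2 - K t).toENNReal := fun t =>
        ((continuous_ereal_sub_coe (K t)).measurable.comp (hd t).2.measurable).ereal_toENNReal
      have hc : ∀ t a b, c t a b = K t + ((c t a b - K t).toENNReal : EReal) := fun t a b => by
        rw [EReal.coe_toENNReal ((EReal.sub_nonneg (by simp) (by simp)).2 (hK t a b)),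
          ereal_coe_add_sub_coe]
      rw [extIntegral_incrementCost hgm hc, extIntegral_incrementCost hgm hc]
      have hm : ∀ t, Measurable fun p : Path (N + 1) × Path (N + 1) =>
          (incr p.1 t, incr p.2 t) := fun t => by fun_prop
      congr 2
      refine Finset.sum_congr rfl fun t _ => ?_
      have := congrArg (fun m => ∫⁻ q, (c t q.1 q.2 - K t).toENNReal ∂m) (hlaw t)
      simpa only [lintegral_map (hgm t) (hm t)] using this
    · push Not at hfin
      obtain ⟨t, ht⟩ := hfin
      rw [incrementCost_eq_top hc_bot ht, extIntegral_top]
      exact le_top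
  · rintro ⟨h, hh, hch⟩
    refine ⟨hKR, le_antisymm (le_iInf₂ fun γ hγ => ?_) (iInf₂_le _ hKR)⟩
    have hγp := isProbabilityMeasure_of_mem_plans hγ.1
    have hKRp := isProbabilityMeasure_of_mem_plans hKR.1
    by_cases hfin : ∀ t, ∃ a b, c t a b ≠ ⊤
    · have hd := bddBelow_and_lowerSemicontinuous_of_incrementCost hc_bot hc_lsc hc_bdd hfin
      choose K hK using fun t => (hd t).1
      set G : Fin (N + 1) → ℝ → ℝ≥0∞ := fun t z => (h t z - K t).toENNReal with hG
      have hhG : ∀ t z, h t z = K t + (G t z : EReal) := fun t z => by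
        have := hK t z 0
        rw [hch, sub_zero] at this
        rw [hG, EReal.coe_toENNReal ((EReal.sub_nonneg (by simp) (by simp)).2 this),
          ereal_coe_add_sub_coe]
      have hhlsc : ∀ t, LowerSemicontinuous (h t) := fun t => by
        have := (hd t).2.comp (by fun_prop : Continuous fun z : ℝ => (z, (0 : ℝ)))
        simpa [hch, Function.comp_def] using this
      have hGlsc : ∀ t, LowerSemicontinuous (G t) := fun t =>
        (EReal.continuous_toENNReal.comp (continuous_ereal_sub_coe (K t))).comp_lowerSemicontinuous
          (hhlsc t) fun x y hxy =>
            EReal.toENNReal_le_toENNReal (monotone_ereal_sub_coe (K t) hxy)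
      have hgm : ∀ t, Measurable fun q : ℝ × ℝ => G t (q.1 - q.2) := fun t =>
        (hGlsc t).measurable.comp (by fun_prop)
      have hc : ∀ t a b, c t a b = K t + (G t (a - b) : EReal) := fun t a b => by
        rw [hch, hhG]
      rw [extIntegral_incrementCost (g := fun t a b => G t (a - b)) hgm hc,
        extIntegral_incrementCost (g := fun t a b => G t (a - b)) hgm hc]
      refine add_le_add le_rfl (EReal.coe_ennreal_le_coe_ennreal_iff.2 ?_)
      exact Finset.sum_le_sum fun t _ =>
        hμ.lintegral_knotheRosenblatt_le hγ ((hh t).ennConvex (hhG t)) (hGlsc t) t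
    · push Not at hfin
      obtain ⟨t, ht⟩ := hfin
      rw [incrementCost_eq_top hc_bot ht, extIntegral_top, extIntegral_top]
  · intro hatom
    have hm := measurable_knotheRosenblattMap (μ := μ) (ν := ν)
    have heq := hμ.knotheRosenblatt_eq_map (ν := ν) hatom
    refine ⟨hm, ?_, heq⟩
    -- The image of `μ` under `T` is the second marginal of the rearrangement.
    have := hKR.1.2
    rw [heq, Measure.map_map (f := fun x => (x, knotheRosenblattMap μ ν x)) measurable_snd
      (measurable_id.prodMk hm)] at this
    exact this
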